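/- **Setting.** Let $X=[x_1,\dots,x_n]\in\mathbb R^{p\times n}$, $y=X^\top w^*+b$ with $\|w^*\|_0\le s^*$ and $\|b\|_0\le\alpha n$, and let $\alpha\le\beta$, $0\le\beta<1$. Put $k=\lfloor\beta n\rfloor$ and $m=n-k$ (so $k=\beta n$, $m=(1-\beta)n$ if $\beta n$ is an integer). TORRENT-HD with target sparsity $s$ starts with $w^0=0$, $S_0=[n]$; in step $t$ it computes an $s$-sparse $w^{t+1}$ from the data in $S_t$ by an update rule and lets $S_{t+1}$ be the set of the $m$ indices with the smallest residuals $|y_i-\langle w^{t+1},x_i\rangle|$ (ties broken arbitrarily). Two update rules are considered: the *exact* update $w^{t+1}\in\arg\min_{\|w\|_0\le s}\sum_{i\in S_t}(y_i-\langle w,x_i\rangle)^2$, and the *IHT* update, where $w^{t+1}$ is the result of $\tau$ steps $u\leftarrow P_s\big(u-h\,X_{S_t}(X_{S_t}^\top u-y_{S_t})\big)$ of iterative hard thresholding from $u=0$, with $P_s$ a Euclidean projection to the $s$-sparse vectors. Let $\Sigma_0$ be positive definite, $\tilde X=\Sigma_0^{-1/2}X$, $\kappa(\cdot)=\lambda_{\max}(\cdot)/\lambda_{\min}(\cdot)$.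 $\tilde X$ satisfies SRSC (resp. SRSS) for sets of size $q$ at sparsity level $r$ with constant $c$ if for all $S\subseteq[n]$ with $|S|=q$ and all $w_1,w_2$ with $\|w_1\|_0\le s_1$, $\|w_2\|_0\le s_2$, $s_1+s_2=r$, the vector $v=\Sigma_0^{1/2}(w_1-w_2)$ satisfies $c\|v\|_2^2\le\|\tilde X_S^\top v\|_2^2$ (resp. $\|\tilde X_S^\top v\|_2^2\le c\|v\|_2^2$). **(1) Fixed design, exact update.** Let $s\ge s^*$, let $\tilde X$ satisfy SRSC for sets of size $m$ at level $s+s^*$ with constant $\alpha_{(1-\beta,s+s^*)}>0$ and SRSS for sets of size $k$ at level $s+s^*$ with constant $L_{(\beta,s+s^*)}$, and let $\eta:=4L_{(\beta,s+s^*)}/\alpha_{(1-\beta,s+s^*)}<1$. Put $K=2\sqrt{nL_{(\beta,s+s^*)}/\lambda_{\min}(\Sigma_0)}\,/\,\alpha_{(1-\beta,s+s^*)}$. Then for every $\epsilon>0$, $\|w^t-w^*\|_2\le\epsilon$ for all integers $t\ge1$ with $$t\ \ge\ 1+\log\Big(K\cdot\tfrac1{\sqrt n}\tfrac{\|b\|_2}{\epsilon}\Big)\Big/\log\tfrac1\eta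 .$$ **(2) Fixed design, IHT update.** Let, in addition to the SRSC and SRSS properties at level $s+s^*$ and $\eta<1$ as in (1), $\tilde X$ satisfy SRSC for sets of size $m$ at level $2s+s^*$ with constant $\bar\alpha>0$, and SRSS for the full set $[n]$ (hence for all its subsets) at level $2s+s^*$ with constant $\bar L$. Let $s\ge32\big(\kappa(\Sigma_0)\bar L/\bar\alpha\big)^2s^*$, $h=2/(3\lambda_{\max}(\Sigma_0)\bar L)$, $\epsilon>0$ and $$\tau\ \ge\ 12\,\kappa(\Sigma_0)\frac{\bar L}{\bar\alpha}\log\frac{4\|y\|_2^2}{(1-\eta)^2\lambda_{\min}(\Sigma_0)\,\alpha_{(1-\beta,s+s^*)}\,\epsilon^2}.$$ Then $\|w^t-w^*\|_2\le\epsilon$ for all integers $t\ge1$ as in (1) with $2K$ in place of $K$. **(3) Gaussian design, exact update.** For every $A$ there is a $C>0$, depending only on $A$, such that the following holds for all $p\ge2$, $s^*\ge1$, positive definite $\Sigma\in\mathbb R^{p\times p}$, $s^*\le s\le A\,s^*\kappa(\Sigma)$ and $n\ge C\,s^*\kappa(\Sigma)\log p$. If $x_1,\dots,x_n$ are independent with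 law $\mathcal N(0,\Sigma)$, then with probability at least $1-1/n^{10}$, simultaneously for all $\alpha\le\beta$ with $0\le\beta<\frac1{65}$, all $w^*$ with $\|w^*\|_0\le s^*$, all $b$ with $\|b\|_0\le\alpha n$ (these may depend on $X$) and all $\epsilon>0$, the exact update gives $\|w^t-w^*\|_2\le\epsilon$ for all $$t\ \ge\ C\Big(1+\max\Big\{0,\ \log\Big(\tfrac{1}{\sqrt{n\lambda_{\min}(\Sigma)}}\tfrac{\|b\|_2}{\epsilon}\Big)\Big\}\Big).$$ **(4) Gaussian design, IHT update.** There is an absolute constant $C>0$ such that, for all $p\ge2$, $s^*\ge1$, positive definite $\Sigma$, $s\ge100\,\kappa(\Sigma)^2s^*$ and $n\ge C\,s\log p$, the conclusion of (3) holds for the IHT update with $h=1/(2n\lambda_{\max}(\Sigma))$ and any $\tau\ge C\,\kappa(\Sigma)\big(1+\max\{0,\log(\|y\|_2/(\sqrt{n\lambda_{\min}(\Sigma)}\,\epsilon))\}\big)$. -/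

import Mathlib

open MeasureTheory ProbabilityTheory
open scoped Matrix

namespace TorrentHD

/-- Euclidean norm of a real vector (given as a plain function on a finite index set). -/
noncomputable def l2 {ι : Type*} [Fintype ι] (v : ι → ℝ) : ℝ :=
  ‖(WithLp.toLp 2 v : EuclideanSpace ℝ ι)‖

/-- Smallest eigenvalue of a real symmetric matrix. -/
noncomputable def lamMin {p : ℕ} (M : Matrix (Fin p) (Fin p) ℝ) : ℝ := sInf (spectrum ℝ M)

/-- Largest eigenvalue of a real symmetric matrix. -/
noncomputable def lamMax {p : ℕ} (M : Matrix (Fin p) (Fin p) ℝ) : ℝ := sSup (spectrum ℝ M)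

/-- Condition number `lamMax / lamMin` of a symmetric positive definite matrix. -/
noncomputable def condNum {p : ℕ} (M : Matrix (Fin p) (Fin p) ℝ) : ℝ := lamMax M / lamMin M

open scoped MatrixOrder in
/-- The positive square root `M^{1/2}` of a positive (semi)definite matrix. -/
noncomputable def rootOf {p : ℕ} (M : Matrix (Fin p) (Fin p) ℝ) : Matrix (Fin p) (Fin p) ℝ :=
  CFC.sqrt M

/-- The submatrix `X_S` whose columns are the data points with index in `S`. -/
def colSub {p n : ℕ} (X : Matrix (Fin p) (Fin n) ℝ) (S : Finset (Fin n)) :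
    Matrix (Fin p) S ℝ :=
  X.submatrix id Subtype.val

/-- Restricted strong convexity of `M` at sparsity level `s` with constant `c`, over the vectors
`R (w₁ - w₂)`, where `w₁`, `w₂` are `s₁`- and `s₂`-sparse and `s₁ + s₂ = s`.
For `R = 1` this is the plain restricted strong convexity property. -/
def RSC {p : ℕ} {ι : Type*} [Fintype ι] (M : Matrix (Fin p) ι ℝ) (R : Matrix (Fin p) (Fin p) ℝ)
    (s : ℕ) (c : ℝ) : Prop :=
  ∀ s₁ s₂ : ℕ, s₁ + s₂ = s → ∀ w₁ w₂ : Fin p → ℝ, hammingNorm w₁ ≤ s₁ → hammingNorm w₂ ≤ s₂ →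
    c * l2 (R *ᵥ (w₁ - w₂)) ^ 2 ≤ l2 (Mᵀ *ᵥ (R *ᵥ (w₁ - w₂))) ^ 2

/-- Restricted strong smoothness, over the same vectors. -/
def RSS {p : ℕ} {ι : Type*} [Fintype ι] (M : Matrix (Fin p) ι ℝ) (R : Matrix (Fin p) (Fin p) ℝ)
    (s : ℕ) (c : ℝ) : Prop :=
  ∀ s₁ s₂ : ℕ, s₁ + s₂ = s → ∀ w₁ w₂ : Fin p → ℝ, hammingNorm w₁ ≤ s₁ → hammingNorm w₂ ≤ s₂ →
    l2 (Mᵀ *ᵥ (R *ᵥ (w₁ - w₂))) ^ 2 ≤ c * l2 (R *ᵥ (w₁ - w₂)) ^ 2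

/-- Subset restricted strong convexity at level `(γ, s)`, where `k = γ n` is the size of the
subsets: restricted strong convexity of `M_S` for every set `S` of `k` columns. -/
def SRSC {p n : ℕ} (M : Matrix (Fin p) (Fin n) ℝ) (R : Matrix (Fin p) (Fin p) ℝ)
    (k s : ℕ) (c : ℝ) : Prop :=
  ∀ S : Finset (Fin n), S.card = k → RSC (colSub M S) R s c

/-- Subset restricted strong smoothness at level `(γ, s)` with `k = γ n`. -/
def SRSS {p n : ℕ} (M : Matrix (Fin p) (Fin n) ℝ) (R : Matrix (Fin p) (Fin p) ℝ)
    (k s : ℕ) (c : ℝ) : Prop :=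
  ∀ S : Finset (Fin n), S.card = k → RSS (colSub M S) R s c

/-- Number of points that may be discarded: `β n`, rounded down if it is not an integer. -/
noncomputable def dropCount (β : ℝ) (n : ℕ) : ℕ := ⌊β * n⌋₊

/-- Number of points that are kept: `(1 - β) n`, rounded up if it is not an integer. -/
noncomputable def keepCount (β : ℝ) (n : ℕ) : ℕ := n - dropCount β n

/-- `S` is a value of the hard thresholding operator `HT(v; k)`: for some permutation `σ` that
orders the entries of `v` by increasing magnitude, `S` consists of the `k` indices that come
first. (Ties may be broken in any way.) -/
def IsHT {n : ℕ} (v : Fin n → ℝ) (k : ℕ) (S : Finset (Fin n)) : Prop :=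
  ∃ σ : Equiv.Perm (Fin n), Monotone (fun i => |v (σ i)|) ∧
    S = Finset.univ.filter (fun i => ((σ.symm i : Fin n) : ℕ) < k)

/-- The residual vector `y - Xᵀ w`. -/
def residual {p n : ℕ} (X : Matrix (Fin p) (Fin n) ℝ) (y : Fin n → ℝ) (w : Fin p → ℝ) :
    Fin n → ℝ :=
  y - Xᵀ *ᵥ w

/-- Least squares loss on the active set `S`. -/
def lossOn {p n : ℕ} (X : Matrix (Fin p) (Fin n) ℝ) (y : Fin n → ℝ) (S : Finset (Fin n))
    (w : Fin p → ℝ) : ℝ :=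
  ∑ i ∈ S, residual X y w i ^ 2

/-- The update of TORRENT-HD: `w'` minimizes the least squares loss on `S` among all `s`-sparse
vectors. -/
def SparseLSUpdate {p n : ℕ} (X : Matrix (Fin p) (Fin n) ℝ) (y : Fin n → ℝ) (s : ℕ)
    (S : Finset (Fin n)) (w' : Fin p → ℝ) : Prop :=
  hammingNorm w' ≤ s ∧ ∀ u : Fin p → ℝ, hammingNorm u ≤ s → lossOn X y S w' ≤ lossOn X y S u

/-- `u` is a Euclidean projection of `z` to the set of `s`-sparse vectors. -/
def IsSparseProj {p : ℕ} (s : ℕ) (z u : Fin p → ℝ) : Prop :=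
  hammingNorm u ≤ s ∧ ∀ v : Fin p → ℝ, hammingNorm v ≤ s → l2 (z - u) ≤ l2 (z - v)

/-- The gradient `X_S (X_Sᵀ w - y_S)` of half the least squares loss on `S`. -/
def gradOn {p n : ℕ} (X : Matrix (Fin p) (Fin n) ℝ) (y : Fin n → ℝ) (S : Finset (Fin n))
    (w : Fin p → ℝ) : Fin p → ℝ :=
  fun a => ∑ i ∈ S, X a i * ((Xᵀ *ᵥ w) i - y i)

/-- The update of TORRENT-HD carried out by iterative hard thresholding: `w'` is the result of
`τ` steps of projected gradient descent onto the `s`-sparse vectors with step length `h`, for half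
the least squares loss on `S`, started at `0`. -/
def IHTUpdate {p n : ℕ} (X : Matrix (Fin p) (Fin n) ℝ) (y : Fin n → ℝ) (s : ℕ) (h : ℝ) (τ : ℕ)
    (S : Finset (Fin n)) (w' : Fin p → ℝ) : Prop :=
  ∃ u : ℕ → Fin p → ℝ, u 0 = 0 ∧
    (∀ j, IsSparseProj s (u j - h • gradOn X y S (u j)) (u (j + 1))) ∧ w' = u τ

/-- `w 0, w 1, …` and `S 0, S 1, …` are the models and active sets produced by TORRENT with
the update rule `U`, keeping `k` points in each thresholding step. -/
def IsTorrentRun {p n : ℕ} (X : Matrix (Fin p) (Fin n) ℝ) (y : Fin n → ℝ) (k : ℕ)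
    (U : Finset (Fin n) → (Fin p → ℝ) → Prop)
    (w : ℕ → Fin p → ℝ) (S : ℕ → Finset (Fin n)) : Prop :=
  w 0 = 0 ∧ S 0 = Finset.univ ∧
    ∀ t, U (S t) (w (t + 1)) ∧ IsHT (residual X y (w (t + 1))) k (S (t + 1))

/-- The corrupted output `y = Xᵀ w* + b`. -/
def output {p n : ℕ} (X : Matrix (Fin p) (Fin n) ℝ) (wstar : Fin p → ℝ) (b : Fin n → ℝ) :
    Fin n → ℝ :=
  Xᵀ *ᵥ wstar + b

/-- The data matrix with the given data points as columns. -/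
def dataMatrix {p n : ℕ} (x : Fin n → EuclideanSpace ℝ (Fin p)) : Matrix (Fin p) (Fin n) ℝ :=
  Matrix.of fun a i => x i a

/-- The law of `n` independent data points, each with distribution `N(0, M)`. -/
noncomputable def gaussianDesign (p n : ℕ) (M : Matrix (Fin p) (Fin p) ℝ) :
    Measure (Fin n → EuclideanSpace ℝ (Fin p)) :=
  Measure.pi fun _ => multivariateGaussian 0 M

end TorrentHD

/-! Let `R = rootOf M`, `U_t = l2 (R *ᵥ (w t - wstar))` and `g = Xᵀ *ᵥ (w t - wstar)`, so that the
residual is `b - g`. Two facts drive the outer loop.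

Update: an update whose loss on `S` is within `e` of that of `wstar` has `∑ g² ≤ 2 ∑ g b + e` over
`S`. The cross term lives on the at most `k` corrupted indices, so Cauchy-Schwarz with smoothness,
against convexity on `S`, gives `U ≤ (2√L / a) ‖b_S‖ + √(e / a)` (`update_error_le`). Thresholding:
the corrupted points kept are no more numerous than the clean points dropped, and their residuals
are no larger than those of the latter, which equal `-g`; hence `‖b_S‖² ≤ 4 L U²`
(`IsHT.sum_corruption_le`). Together `U_{t+1} ≤ η U_t + √(e / a)` with `η = 4L / a`
(`IsTorrentRun.error_le`). The exact update has `e = 0`.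

For IHT, projecting to a sparsity `s` much larger than `sstar` costs only a fraction `sstar / s` of
the squared distance to an `sstar`-sparse vector (`IsSparseProj.sum_sq_le`). With `s` of order `κ²
sstar` this loss is beaten by the gradient decrease, so the excess loss shrinks by `1 - A / (12 Lm)`
per step and `e` decays exponentially in `τ`.

For Gaussian designs, Chernoff bounds control the predictions of one fixed vector, and a union over
a net of sparse vectors makes this uniform. The mass on every small index set is controlled by
truncation, `∑_T z² ≤ κ |T| + ∑ (z² - κ)₊`, which needs no union over `T`. Below the fraction `1/65`
this gives `L = 0.193 n`, `a = 0.782 n` and `η = 386/391 < 1`. -/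

namespace TorrentHD

/-! ### Euclidean norm and support size. -/

section Norms

variable {ι : Type*} [Fintype ι]

lemma l2_sq (v : ι → ℝ) : l2 v ^ 2 = ∑ i, v i ^ 2 := by
  simp [l2, EuclideanSpace.norm_sq_eq]

lemma l2_nonneg (v : ι → ℝ) : 0 ≤ l2 v := norm_nonneg _

lemma l2_eq_zero {v : ι → ℝ} : l2 v = 0 ↔ v = 0 := by
  simp [l2]

lemma l2_zero : l2 (0 : ι → ℝ) = 0 := l2_eq_zero.2 rfl

lemma sum_sq_le_l2_sq (v : ι → ℝ) (S : Finset ι) : ∑ i ∈ S, v i ^ 2 ≤ l2 v ^ 2 := by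
  rw [l2_sq]
  exact Finset.sum_le_sum_of_subset_of_nonneg (Finset.subset_univ _) fun i _ _ => sq_nonneg _

lemma hammingNorm_le_card_of_support [DecidableEq ι] {v : ι → ℝ} {J : Finset ι}
    (h : ∀ i, i ∉ J → v i = 0) : hammingNorm v ≤ J.card := by
  refine Finset.card_le_card fun i hi => ?_
  by_contra hJ
  simp [h i hJ] at hi

end Norms

/-! ### Whitening and extreme eigenvalues. -/

section Design

variable {p n : ℕ}

lemma l2_colSub_sq (M : Matrix (Fin p) (Fin n) ℝ) (S : Finset (Fin n)) (v : Fin p → ℝ) :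
    l2 ((colSub M S)ᵀ *ᵥ v) ^ 2 = ∑ i ∈ S, (Mᵀ *ᵥ v) i ^ 2 := by
  rw [l2_sq, ← Finset.sum_coe_sort S]
  rfl

open scoped MatrixOrder in
lemma rootOf_mul_self {M : Matrix (Fin p) (Fin p) ℝ} (hM : M.PosDef) :
    rootOf M * rootOf M = M :=
  CFC.sqrt_mul_sqrt_self M (Matrix.nonneg_iff_posSemidef.2 hM.posSemidef)

open scoped MatrixOrder in
lemma rootOf_transpose (M : Matrix (Fin p) (Fin p) ℝ) : (rootOf M)ᵀ = rootOf M := by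
  have h : (rootOf M).PosSemidef := Matrix.nonneg_iff_posSemidef.1 (CFC.sqrt_nonneg M)
  have h2 := h.isHermitian.eq
  rwa [Matrix.conjTranspose_eq_transpose_of_trivial] at h2

lemma rootOf_isUnit_det {M : Matrix (Fin p) (Fin p) ℝ} (hM : M.PosDef) :
    IsUnit (rootOf M).det := by
  have h : (rootOf M).det * (rootOf M).det = M.det := by
    rw [← Matrix.det_mul, rootOf_mul_self hM]
  rw [isUnit_iff_ne_zero]
  intro h0
  have := hM.det_pos
  rw [← h, h0] at this
  simp at this

/-- Whitening cancels in predictions: the restricted properties of the whitened design compare the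
predictions of `X` itself with the `M`-weighted norm. -/
lemma whitened_mulVec {M : Matrix (Fin p) (Fin p) ℝ} (hM : M.PosDef)
    (X : Matrix (Fin p) (Fin n) ℝ) (v : Fin p → ℝ) :
    ((rootOf M)⁻¹ * X)ᵀ *ᵥ (rootOf M *ᵥ v) = Xᵀ *ᵥ v := by
  rw [Matrix.mulVec_mulVec, Matrix.transpose_mul, Matrix.transpose_nonsing_inv, rootOf_transpose,
    Matrix.mul_assoc, Matrix.nonsing_inv_mul _ (rootOf_isUnit_det hM), Matrix.mul_one]

lemma l2_rootOf_sq {M : Matrix (Fin p) (Fin p) ℝ} (hM : M.PosDef) (v : Fin p → ℝ) :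
    l2 (rootOf M *ᵥ v) ^ 2 = v ⬝ᵥ (M *ᵥ v) := by
  have : l2 (rootOf M *ᵥ v) ^ 2 = (rootOf M *ᵥ v) ⬝ᵥ (rootOf M *ᵥ v) := by
    rw [l2_sq]; exact Finset.sum_congr rfl fun i _ => by ring
  rw [this, Matrix.dotProduct_mulVec, Matrix.vecMul_mulVec, ← Matrix.dotProduct_mulVec,
    rootOf_transpose, rootOf_mul_self hM, dotProduct_comm]

lemma l2_rootOf_eq_zero {M : Matrix (Fin p) (Fin p) ℝ} (hM : M.PosDef) {v : Fin p → ℝ}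
    (h : l2 (rootOf M *ᵥ v) = 0) : v = 0 := by
  rw [l2_eq_zero] at h
  have := congrArg (fun u => (rootOf M)⁻¹ *ᵥ u) h
  simpa [Matrix.mulVec_mulVec, Matrix.nonsing_inv_mul _ (rootOf_isUnit_det hM)] using this

lemma quadForm_eq_sum_eigenvalues {M : Matrix (Fin p) (Fin p) ℝ} (hM : M.IsHermitian)
    (v : Fin p → ℝ) : ∃ c : Fin p → ℝ, l2 v ^ 2 = ∑ i, c i ^ 2 ∧
      v ⬝ᵥ (M *ᵥ v) = ∑ i, hM.eigenvalues i * c i ^ 2 := by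
  set b := hM.eigenvectorBasis
  let x : EuclideanSpace ℝ (Fin p) := WithLp.toLp 2 v
  refine ⟨fun i => b.repr x i, ?_, ?_⟩
  · rw [l2, ← b.repr.norm_map, EuclideanSpace.norm_sq_eq]
    simp [x]
  · have hv : v = ∑ i, b.repr x i • (b i : Fin p → ℝ) := by
      have := congrArg (WithLp.ofLp) (b.sum_repr x)
      simpa [x] using this.symm
    have hMv : M *ᵥ v = ∑ i, (hM.eigenvalues i * b.repr x i) • (b i : Fin p → ℝ) := by
      conv_lhs => rw [hv]
      rw [Matrix.mulVec_sum]
      refine Finset.sum_congr rfl fun i _ => ?_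
      rw [Matrix.mulVec_smul, hM.mulVec_eigenvectorBasis, smul_smul, mul_comm]
    rw [hMv, dotProduct_sum]
    refine Finset.sum_congr rfl fun i _ => ?_
    have : v ⬝ᵥ (b i : Fin p → ℝ) = b.repr x i := by
      rw [b.repr_apply_apply]
      simp [x, dotProduct, PiLp.inner_apply]
    rw [dotProduct_smul, this]
    simp; ring

lemma spectrum_finite (M : Matrix (Fin p) (Fin p) ℝ) (hM : M.IsHermitian) :
    (spectrum ℝ M).Finite := by
  rw [hM.spectrum_real_eq_range_eigenvalues]
  exact Set.finite_range _

lemma lamMin_mul_le {M : Matrix (Fin p) (Fin p) ℝ} (hM : M.PosDef) (v : Fin p → ℝ) :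
    lamMin M * l2 v ^ 2 ≤ l2 (rootOf M *ᵥ v) ^ 2 := by
  obtain ⟨c, h1, h2⟩ := quadForm_eq_sum_eigenvalues hM.isHermitian v
  rw [l2_rootOf_sq hM, h1, h2, Finset.mul_sum]
  refine Finset.sum_le_sum fun i _ => mul_le_mul_of_nonneg_right ?_ (sq_nonneg _)
  refine csInf_le (spectrum_finite M hM.isHermitian).bddBelow ?_
  rw [hM.isHermitian.spectrum_real_eq_range_eigenvalues]
  exact ⟨i, rfl⟩

lemma le_lamMax_mul {M : Matrix (Fin p) (Fin p) ℝ} (hM : M.PosDef) (v : Fin p → ℝ) :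
    l2 (rootOf M *ᵥ v) ^ 2 ≤ lamMax M * l2 v ^ 2 := by
  obtain ⟨c, h1, h2⟩ := quadForm_eq_sum_eigenvalues hM.isHermitian v
  rw [l2_rootOf_sq hM, h1, h2, Finset.mul_sum]
  refine Finset.sum_le_sum fun i _ => mul_le_mul_of_nonneg_right ?_ (sq_nonneg _)
  refine le_csSup (spectrum_finite M hM.isHermitian).bddAbove ?_
  rw [hM.isHermitian.spectrum_real_eq_range_eigenvalues]
  exact ⟨i, rfl⟩

lemma lamMin_pos {M : Matrix (Fin p) (Fin p) ℝ} (hM : M.PosDef) (hp : 0 < p) : 0 < lamMin M := by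
  have : Nonempty (Fin p) := ⟨⟨0, hp⟩⟩
  have hne : (spectrum ℝ M).Nonempty := by
    rw [hM.isHermitian.spectrum_real_eq_range_eigenvalues]
    exact Set.range_nonempty _
  have hmem := hne.csInf_mem (spectrum_finite M hM.isHermitian)
  rw [hM.isHermitian.spectrum_real_eq_range_eigenvalues] at hmem
  obtain ⟨i, hi⟩ := hmem
  rw [lamMin, hM.isHermitian.spectrum_real_eq_range_eigenvalues, ← hi]
  exact hM.eigenvalues_pos i

lemma lamMin_le_lamMax {M : Matrix (Fin p) (Fin p) ℝ} (hM : M.PosDef) :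
    lamMin M ≤ lamMax M := by
  rcases Nat.eq_zero_or_pos p with rfl | hp
  -- The spectrum is empty here, and `sInf ∅ = sSup ∅ = 0`.
  · simp [lamMin, lamMax]
  · have : Nonempty (Fin p) := ⟨⟨0, hp⟩⟩
    have hne : (spectrum ℝ M).Nonempty := by
      rw [hM.isHermitian.spectrum_real_eq_range_eigenvalues]
      exact Set.range_nonempty _
    have hf := spectrum_finite M hM.isHermitian
    exact csInf_le_csSup hne hf.bddBelow hf.bddAbove

lemma one_le_condNum {M : Matrix (Fin p) (Fin p) ℝ} (hM : M.PosDef) (hp : 0 < p) :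
    1 ≤ condNum M := by
  rw [condNum, one_le_div (lamMin_pos hM hp)]
  exact lamMin_le_lamMax hM

end Design

/-! ### Corruptions that survive hard thresholding. -/

section HardThresholding

variable {n : ℕ}

lemma IsHT.card {v : Fin n → ℝ} {k : ℕ} {S : Finset (Fin n)} (h : IsHT v k S) (hk : k ≤ n) :
    S.card = k := by
  obtain ⟨σ, -, rfl⟩ := h
  have : (Finset.univ.filter fun i => ((σ.symm i : Fin n) : ℕ) < k) =
      (Finset.univ.filter fun i : Fin n => (i : ℕ) < k).map σ.toEmbedding := by
    ext i
    simp [Finset.mem_map_equiv]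
  rw [this, Finset.card_map, Fin.card_filter_val_lt]
  exact min_eq_right hk

lemma IsHT.abs_le {v : Fin n → ℝ} {k : ℕ} {S : Finset (Fin n)} (h : IsHT v k S) {i j : Fin n}
    (hi : i ∈ S) (hj : j ∉ S) : |v i| ≤ |v j| := by
  obtain ⟨σ, hσ, rfl⟩ := h
  simp only [Finset.mem_filter, Finset.mem_univ, true_and, not_lt] at hi hj
  have := hσ (a := σ.symm i) (b := σ.symm j) (by
    rw [Fin.le_def]; omega)
  simpa using this

lemma sum_le_sum_of_card_le {ι : Type*} {f : ι → ℝ} (hf : ∀ i, 0 ≤ f i) {P Q : Finset ι}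
    (h : ∀ i ∈ P, ∀ j ∈ Q, f i ≤ f j) (hc : P.card ≤ Q.card) :
    ∑ i ∈ P, f i ≤ ∑ j ∈ Q, f j := by
  rcases Q.eq_empty_or_nonempty with rfl | hQ
  · have : P = ∅ := by simpa using hc
    simp [this]
  · obtain ⟨j₀, hj₀, hmin⟩ := Q.exists_min_image f hQ
    calc ∑ i ∈ P, f i ≤ P.card • f j₀ := Finset.sum_le_card_nsmul _ _ _ fun i hi => h i hi _ hj₀
      _ ≤ Q.card • f j₀ := nsmul_le_nsmul_left (hf _) hc
      _ ≤ ∑ j ∈ Q, f j := Finset.card_nsmul_le_sum _ _ _ hmin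

/-- After hard thresholding the residuals `b - g`, the corruptions left in the active set are
controlled by the prediction errors `g` on small sets. -/
lemma IsHT.sum_corruption_le {b g : Fin n → ℝ} {k m : ℕ} (hkm : m + k = n) {S : Finset (Fin n)}
    (h : IsHT (b - g) m S) (hb : hammingNorm b ≤ k) {c : ℝ}
    (hg : ∀ T : Finset (Fin n), T.card ≤ k → ∑ i ∈ T, g i ^ 2 ≤ c) :
    ∑ i ∈ S, b i ^ 2 ≤ 4 * c := by
  classical
  set B : Finset (Fin n) := Finset.univ.filter fun i => b i ≠ 0 with hB
  have hBk : B.card ≤ k := hb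
  have hS : S.card = m := h.card (by omega)
  have hSc : Sᶜ.card = k := by rw [Finset.card_compl, hS, Fintype.card_fin]; omega
  -- Both `B` and `Sᶜ` lose the same set `B ∩ Sᶜ`, and `B.card ≤ k = Sᶜ.card`.
  have hcard : (S ∩ B).card ≤ (Sᶜ \ B).card := by
    have h1 : (B ∩ S).card + (B \ S).card = B.card := Finset.card_inter_add_card_sdiff B S
    have h2 : (Sᶜ ∩ B).card + (Sᶜ \ B).card = Sᶜ.card := Finset.card_inter_add_card_sdiff Sᶜ B
    have h3 : B \ S = Sᶜ ∩ B := by ext; simp [and_comm]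
    rw [h3] at h1
    rw [Finset.inter_comm]
    omega
  have hP : ∑ i ∈ S ∩ B, (b i - g i) ^ 2 ≤ ∑ i ∈ Sᶜ \ B, (b i - g i) ^ 2 := by
    refine sum_le_sum_of_card_le (fun i => sq_nonneg _) (fun i hi j hj => ?_) hcard
    exact sq_le_sq.2 (h.abs_le (Finset.mem_inter.1 hi).1
      (Finset.mem_compl.1 (Finset.mem_sdiff.1 hj).1))
  have hQ : ∑ i ∈ Sᶜ \ B, (b i - g i) ^ 2 ≤ c := by
    refine le_trans (le_of_eq (Finset.sum_congr rfl fun i hi => ?_)) (hg (Sᶜ \ B) ?_)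
    · have : b i = 0 := by
        by_contra hne
        exact (Finset.mem_sdiff.1 hi).2 (by simp [hB, hne])
      rw [this]; ring
    · exact (Finset.card_le_card Finset.sdiff_subset).trans hSc.le
  have hG : ∑ i ∈ S ∩ B, g i ^ 2 ≤ c :=
    hg _ ((Finset.card_le_card Finset.inter_subset_right).trans hBk)
  have hsupp : ∑ i ∈ S, b i ^ 2 = ∑ i ∈ S ∩ B, b i ^ 2 := by
    symm
    refine Finset.sum_subset Finset.inter_subset_left fun i hi hi' => ?_
    have : b i = 0 := by
      by_contra hne
      exact hi' (by simp [hB, hne, hi])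
    simp [this]
  have hle : ∑ i ∈ S ∩ B, b i ^ 2 ≤ ∑ i ∈ S ∩ B, (2 * (b i - g i) ^ 2 + 2 * g i ^ 2) :=
    Finset.sum_le_sum fun i _ => by nlinarith [sq_nonneg (b i - 2 * g i)]
  rw [Finset.sum_add_distrib, ← Finset.mul_sum, ← Finset.mul_sum] at hle
  linarith

end HardThresholding

/-! ### Restricted convexity and smoothness as inequalities for sums. -/

section RestrictedProperties

variable {p n : ℕ}

/-- Convexity passes to larger index sets because the summands are nonnegative. This is needed for
the initial active set, which has all `n` points. -/
lemma SRSC.le_sum {X : Matrix (Fin p) (Fin n) ℝ} {M : Matrix (Fin p) (Fin p) ℝ} (hM : M.PosDef)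
    {m r : ℕ} {c : ℝ} (h : SRSC ((rootOf M)⁻¹ * X) (rootOf M) m r c) {s₁ s₂ : ℕ} (hs : s₁ + s₂ = r)
    {v w : Fin p → ℝ} (hv : hammingNorm v ≤ s₁) (hw : hammingNorm w ≤ s₂) {S : Finset (Fin n)}
    (hS : m ≤ S.card) :
    c * l2 (rootOf M *ᵥ (v - w)) ^ 2 ≤ ∑ i ∈ S, (Xᵀ *ᵥ (v - w)) i ^ 2 := by
  obtain ⟨T, hTS, hT⟩ := Finset.exists_subset_card_eq hS
  have := h T hT s₁ s₂ hs v w hv hw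
  rw [l2_colSub_sq, whitened_mulVec hM] at this
  exact this.trans (Finset.sum_le_sum_of_subset_of_nonneg hTS fun i _ _ => sq_nonneg _)

lemma SRSS.sum_le {X : Matrix (Fin p) (Fin n) ℝ} {M : Matrix (Fin p) (Fin p) ℝ} (hM : M.PosDef)
    {k r : ℕ} {c : ℝ} (h : SRSS ((rootOf M)⁻¹ * X) (rootOf M) k r c) {s₁ s₂ : ℕ} (hs : s₁ + s₂ = r)
    {v w : Fin p → ℝ} (hv : hammingNorm v ≤ s₁) (hw : hammingNorm w ≤ s₂) {S : Finset (Fin n)}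
    (hS : S.card ≤ k) (hk : k ≤ n) :
    ∑ i ∈ S, (Xᵀ *ᵥ (v - w)) i ^ 2 ≤ c * l2 (rootOf M *ᵥ (v - w)) ^ 2 := by
  obtain ⟨T, hTS, -, hT⟩ := Finset.exists_subsuperset_card_eq (Finset.subset_univ S) hS
    (by simpa using hk)
  have := h T hT s₁ s₂ hs v w hv hw
  rw [l2_colSub_sq, whitened_mulVec hM] at this
  exact le_trans (Finset.sum_le_sum_of_subset_of_nonneg hTS fun i _ _ => sq_nonneg _) this

lemma dropCount_le {β : ℝ} (h0 : 0 ≤ β) (h1 : β < 1) : dropCount β n ≤ n := by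
  have h : (dropCount β n : ℝ) ≤ β * n := Nat.floor_le (by positivity)
  have : (dropCount β n : ℝ) ≤ n := h.trans (by nlinarith [(Nat.cast_nonneg n : (0 : ℝ) ≤ n)])
  exact_mod_cast this

lemma keepCount_add_dropCount {β : ℝ} (h0 : 0 ≤ β) (h1 : β < 1) :
    keepCount β n + dropCount β n = n :=
  Nat.sub_add_cancel (dropCount_le h0 h1)

lemma hammingNorm_le_dropCount {α β : ℝ} (hαβ : α ≤ β) {b : Fin n → ℝ}
    (hb : (hammingNorm b : ℝ) ≤ α * n) : hammingNorm b ≤ dropCount β n :=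
  Nat.le_floor (hb.trans (by gcongr))

end RestrictedProperties

/-! ### Contraction of the outer iteration. -/

section Run

variable {p n : ℕ}

lemma residual_output (X : Matrix (Fin p) (Fin n) ℝ) (wstar w : Fin p → ℝ) (b : Fin n → ℝ) :
    residual X (output X wstar b) w = b - Xᵀ *ᵥ (w - wstar) := by
  rw [residual, output, Matrix.mulVec_sub]
  abel

lemma lossOn_output_self (X : Matrix (Fin p) (Fin n) ℝ) (wstar : Fin p → ℝ) (b : Fin n → ℝ)
    (S : Finset (Fin n)) : lossOn X (output X wstar b) S wstar = ∑ i ∈ S, b i ^ 2 := by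
  simp [lossOn, residual_output]

lemma le_add_of_mul_sq_le {a U P e : ℝ} (ha : 0 < a) (hP : 0 ≤ P) (he : 0 ≤ e)
    (h : a * U ^ 2 ≤ a * (P * U) + e) : U ≤ P + √(e / a) := by
  by_contra! hlt
  have hq : 0 ≤ √(e / a) := Real.sqrt_nonneg _
  have hsq : √(e / a) ^ 2 = e / a := Real.sq_sqrt (by positivity)
  have h1 : a * √(e / a) ^ 2 = e := by rw [hsq]; field_simp
  have h2 : √(e / a) ^ 2 < U * (U - P) := by nlinarith
  nlinarith [mul_lt_mul_of_pos_left h2 ha]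

/-- One update from a set `S` on which the corruptions have squared norm at most `B ^ 2`. -/
lemma update_error_le {b g : Fin n → ℝ} {S : Finset (Fin n)} {k : ℕ} {a L U B e : ℝ} (ha : 0 < a)
    (hL : 0 ≤ L) (hU : 0 ≤ U) (hB : 0 ≤ B) (he : 0 ≤ e)
    (hloss : ∑ i ∈ S, (b i - g i) ^ 2 ≤ ∑ i ∈ S, b i ^ 2 + e)
    (hlow : a * U ^ 2 ≤ ∑ i ∈ S, g i ^ 2)
    (hup : ∀ T : Finset (Fin n), T.card ≤ k → ∑ i ∈ T, g i ^ 2 ≤ L * U ^ 2)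
    (hb : hammingNorm b ≤ k) (hbS : ∑ i ∈ S, b i ^ 2 ≤ B ^ 2) :
    U ≤ 2 * √L / a * B + √(e / a) := by
  classical
  have h1 : ∑ i ∈ S, (b i - g i) ^ 2 =
      ∑ i ∈ S, b i ^ 2 - 2 * ∑ i ∈ S, g i * b i + ∑ i ∈ S, g i ^ 2 := by
    rw [Finset.mul_sum, ← Finset.sum_sub_distrib, ← Finset.sum_add_distrib]
    exact Finset.sum_congr rfl fun i _ => by ring
  -- Only corrupted indices enter the cross term, so smoothness on sets of size `k` suffices and the
  -- small constant `L` appears.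
  have hT : (S.filter fun i => b i ≠ 0).card ≤ k :=
    (Finset.card_le_card (Finset.filter_subset_filter _ (Finset.subset_univ S))).trans hb
  have h2 : ∑ i ∈ S, g i * b i = ∑ i ∈ S.filter fun i => b i ≠ 0, g i * b i := by
    symm
    refine Finset.sum_subset (Finset.filter_subset _ _) fun i hi hi' => ?_
    have : b i = 0 := by
      by_contra hne
      exact hi' (by simp [hi, hne])
    simp [this]
  have h3 : (∑ i ∈ S, g i * b i) ^ 2 ≤ (√L * U * B) ^ 2 := by
    rw [h2]
    refine (Finset.sum_mul_sq_le_sq_mul_sq _ _ _).trans ?_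
    rw [mul_pow, mul_pow, Real.sq_sqrt hL]
    refine mul_le_mul (hup _ hT) (le_trans ?_ hbS) (Finset.sum_nonneg fun i _ => sq_nonneg _)
      (by positivity)
    exact Finset.sum_le_sum_of_subset_of_nonneg (Finset.filter_subset _ _) fun i _ _ => sq_nonneg _
  have h4 : ∑ i ∈ S, g i * b i ≤ √L * U * B := le_of_abs_le (abs_le_of_sq_le_sq h3 (by positivity))
  refine le_add_of_mul_sq_le ha (by positivity) he ?_
  have h5 : a * (2 * √L / a * B * U) = 2 * (√L * U * B) := by field_simp
  linarith

/-- Linear convergence of TORRENT up to the accuracy of the updates. -/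
theorem IsTorrentRun.error_le {X : Matrix (Fin p) (Fin n) ℝ} {R : Matrix (Fin p) (Fin p) ℝ}
    {wstar : Fin p → ℝ} {b : Fin n → ℝ} {m k s : ℕ} (hmk : m + k = n) {a L e : ℝ} (ha : 0 < a)
    (hL : 0 ≤ L) (he : 0 ≤ e) (hη : 4 * L / a < 1)
    (hlow : ∀ w, hammingNorm w ≤ s → ∀ S : Finset (Fin n), m ≤ S.card →
      a * l2 (R *ᵥ (w - wstar)) ^ 2 ≤ ∑ i ∈ S, (Xᵀ *ᵥ (w - wstar)) i ^ 2)
    (hup : ∀ w, hammingNorm w ≤ s → ∀ T : Finset (Fin n), T.card ≤ k →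
      ∑ i ∈ T, (Xᵀ *ᵥ (w - wstar)) i ^ 2 ≤ L * l2 (R *ᵥ (w - wstar)) ^ 2)
    (hb : hammingNorm b ≤ k)
    {U : Finset (Fin n) → (Fin p → ℝ) → Prop}
    (hU : ∀ S w', m ≤ S.card → U S w' → hammingNorm w' ≤ s ∧
      lossOn X (output X wstar b) S w' ≤ lossOn X (output X wstar b) S wstar + e)
    {w : ℕ → Fin p → ℝ} {S : ℕ → Finset (Fin n)}
    (hrun : IsTorrentRun X (output X wstar b) m U w S) (t : ℕ) :
    l2 (R *ᵥ (w (t + 1) - wstar)) ≤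
      (4 * L / a) ^ t * (2 * √L / a * l2 b) + √(e / a) / (1 - 4 * L / a) := by
  obtain ⟨-, hS0, hstep⟩ := hrun
  have hcard : ∀ t, m ≤ (S t).card := by
    rintro (_ | t)
    · rw [hS0, Finset.card_univ, Fintype.card_fin]; omega
    · rw [(hstep t).2.card (by omega)]
  have hbound : ∀ t B, 0 ≤ B → ∑ i ∈ S t, b i ^ 2 ≤ B ^ 2 →
      l2 (R *ᵥ (w (t + 1) - wstar)) ≤ 2 * √L / a * B + √(e / a) := by
    intro t B hB hbS
    obtain ⟨hsp, hloss⟩ := hU _ _ (hcard t) (hstep t).1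
    refine update_error_le (g := Xᵀ *ᵥ (w (t + 1) - wstar)) (S := S t) (k := k) ha hL (l2_nonneg _)
      hB he ?_ (hlow _ hsp _ (hcard t)) (hup _ hsp) hb hbS
    rw [lossOn_output_self] at hloss
    simpa [lossOn, residual_output] using hloss
  have hq : 0 ≤ √(e / a) := Real.sqrt_nonneg _
  have hη0 : 0 ≤ 4 * L / a := by positivity
  have hden : 0 < 1 - 4 * L / a := by linarith
  induction t with
  | zero =>
    have h := hbound 0 (l2 b) (l2_nonneg _) (sum_sq_le_l2_sq _ _)
    have : √(e / a) ≤ √(e / a) / (1 - 4 * L / a) := by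
      rw [le_div_iff₀ hden]; nlinarith
    simpa using h.trans (by linarith)
  | succ t ih =>
    obtain ⟨hsp, -⟩ := hU _ _ (hcard t) (hstep t).1
    have hht := (hstep t).2
    rw [residual_output] at hht
    have hc := hht.sum_corruption_le hmk hb (hup _ hsp)
    set V := l2 (R *ᵥ (w (t + 1) - wstar)) with hV
    have hV0 : 0 ≤ V := l2_nonneg _
    have h := hbound (t + 1) (2 * √L * V) (by positivity) (hc.trans (le_of_eq (by
      rw [mul_pow, mul_pow, Real.sq_sqrt hL]; ring)))
    have h1 : 2 * √L / a * (2 * √L * V) = 4 * L / a * V := by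
      rw [show 2 * √L / a * (2 * √L * V) = 4 * (√L * √L) / a * V by ring, Real.mul_self_sqrt hL]
    rw [h1] at h
    have h2 := mul_le_mul_of_nonneg_left ih hη0
    -- The accumulated inaccuracy is the fixed point of `x ↦ η x + √(e / a)`.
    have h3 : √(e / a) / (1 - 4 * L / a) =
        4 * L / a * (√(e / a) / (1 - 4 * L / a)) + √(e / a) := by
      generalize 4 * L / a = η at *
      field_simp; ring
    rw [pow_succ']
    nlinarith

/-- For `η = 0` the quotient of logarithms is `0` by convention and bounds nothing at `t = 0`; `h0`
covers that case. In the application `η` and `D` both vanish with `L`. -/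
lemma pow_mul_le_of_log_le {η D ε : ℝ} (hη0 : 0 ≤ η) (hη1 : η < 1) (hD : 0 ≤ D) (hε : 0 < ε)
    (h0 : η = 0 → D = 0) {t : ℕ} (ht : 1 + Real.log (D / ε) / Real.log (1 / η) ≤ t + 1) :
    η ^ t * D ≤ ε := by
  rcases hD.eq_or_lt with rfl | hD
  · simpa using hε.le
  have hη : 0 < η := lt_of_le_of_ne hη0 fun h => hD.ne' (h0 h.symm)
  have hlog : 0 < Real.log (1 / η) := Real.log_pos (by rw [lt_div_iff₀ hη]; linarith)
  have h1 : Real.log (D / ε) ≤ t * Real.log (1 / η) := by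
    rw [← div_le_iff₀ hlog]; linarith
  rw [← Real.log_pow, Real.log_le_log_iff (by positivity) (by positivity), div_le_iff₀ hε,
    one_div, inv_pow] at h1
  calc η ^ t * D ≤ η ^ t * ((η ^ t)⁻¹ * ε) := by gcongr
    _ = ε := by field_simp

end Run

/-! ### Linear convergence of iterative hard thresholding. -/

section IterativeHardThresholding

variable {p n : ℕ}

/-- Discarding a largest value repeatedly never raises the average. -/
lemma exists_subset_card_mul_sum_le {ι : Type*} [DecidableEq ι] {f : ι → ℝ}
    (F : Finset ι) {e : ℕ} (he : e ≤ F.card) :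
    ∃ E ⊆ F, E.card = e ∧ (F.card : ℝ) * ∑ i ∈ E, f i ≤ e * ∑ i ∈ F, f i := by
  induction hd : F.card - e generalizing F with
  | zero =>
    exact ⟨F, subset_rfl, by omega, by rw [show e = F.card by omega]⟩
  | succ d ih =>
    have hF : F.Nonempty := Finset.card_pos.1 (by omega)
    obtain ⟨j, hj, hmax⟩ := F.exists_max_image f hF
    have hc : (F.erase j).card + 1 = F.card := Finset.card_erase_add_one hj
    obtain ⟨E, hE, hEc, hle⟩ := ih (F.erase j) (by omega) (by omega)
    refine ⟨E, hE.trans (Finset.erase_subset _ _), hEc, ?_⟩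
    have h1 : ∑ i ∈ E, f i ≤ e * f j := by
      have := Finset.sum_le_card_nsmul E f (f j)
        fun i hi => hmax i (Finset.mem_of_mem_erase (hE hi))
      rwa [hEc, nsmul_eq_mul] at this
    have h2 := Finset.add_sum_erase F f hj
    have h3 : (F.card : ℝ) = (F.erase j).card + 1 := by exact_mod_cast hc.symm
    rw [h3, ← h2]
    nlinarith

/-- Bound on the error of a sparse projection in terms of the distance to a much sparser vector
`θ'`, measured on the joint support of `θ'` and another `s`-sparse vector. -/
lemma IsSparseProj.sum_sq_le {s sstar : ℕ} {z u θ θ' : Fin p → ℝ} (h : IsSparseProj s z u)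
    (hθ : hammingNorm θ ≤ s) (hθ' : hammingNorm θ' ≤ sstar) (hs : sstar ≤ s)
    {J : Finset (Fin p)} (hJ : J = Finset.univ.filter fun i => θ i ≠ 0 ∨ θ' i ≠ 0) :
    ∑ i, (z i - u i) ^ 2 ≤
      ∑ i ∈ Jᶜ, z i ^ 2 + (sstar : ℝ) / s * ∑ i ∈ J, (z i - θ' i) ^ 2 := by
  classical
  set A := Finset.univ.filter fun i => θ i ≠ 0 with hA
  set B := Finset.univ.filter fun i => θ' i ≠ 0 with hB
  have hAc : A.card ≤ s := hθ
  have hBc : B.card ≤ sstar := hθ'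
  have hJAB : J = A ∪ B := by rw [hJ, hA, hB, Finset.filter_or]
  have hF : J \ B = A \ B := by rw [hJAB, Finset.union_sdiff_right]
  have hJc : (J \ B).card + B.card = J.card :=
    Finset.card_sdiff_add_card_eq_card (hJAB ▸ Finset.subset_union_right)
  have hFs : (J \ B).card ≤ s := by
    rw [hF]; exact (Finset.card_le_card Finset.sdiff_subset).trans hAc
  -- The competitor is `z` restricted to `J`, minus just enough cheap coordinates `E` to become
  -- `s`-sparse. They are taken off the support of `θ'`, where `z = z - θ'`. The truncated `J.card -
  -- s` makes `E` empty if `J` is already small.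
  obtain ⟨E, hE, hEc, hEle⟩ := exists_subset_card_mul_sum_le (f := fun i => z i ^ 2)
    (J \ B) (e := J.card - s) (by omega)
  have hEJ : E ⊆ J := hE.trans Finset.sdiff_subset
  have hv : hammingNorm (fun i => if i ∈ J \ E then z i else 0) ≤ s := by
    refine (hammingNorm_le_card_of_support (J := J \ E) fun i hi => by simp [hi]).trans ?_
    rw [Finset.card_sdiff_of_subset hEJ]
    omega
  have h1 := pow_le_pow_left₀ (l2_nonneg _) (h.2 _ hv) 2
  simp only [l2_sq, Pi.sub_apply] at h1
  refine h1.trans ?_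
  have h2 : ∑ i, (z i - if i ∈ J \ E then z i else 0) ^ 2 =
      ∑ i ∈ Jᶜ, z i ^ 2 + ∑ i ∈ E, z i ^ 2 := by
    rw [← Finset.sum_compl_add_sum J]
    congr 1
    · refine Finset.sum_congr rfl fun i hi => ?_
      simp [Finset.mem_compl.1 hi]
    · rw [← Finset.sum_subset hEJ]
      · refine Finset.sum_congr rfl fun i hi => ?_
        simp [hi]
      · intro i hi hi'
        simp [hi, hi']
  rw [h2]
  gcongr
  have h3 : ∑ i ∈ J \ B, z i ^ 2 ≤ ∑ i ∈ J, (z i - θ' i) ^ 2 := by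
    refine le_trans (le_of_eq (Finset.sum_congr rfl fun i hi => ?_))
      (Finset.sum_le_sum_of_subset_of_nonneg Finset.sdiff_subset fun i _ _ => sq_nonneg _)
    have : θ' i = 0 := by
      by_contra hne
      exact (Finset.mem_sdiff.1 hi).2 (by simp [hB, hne])
    rw [this, sub_zero]
  have h30 : 0 ≤ ∑ i ∈ J \ B, z i ^ 2 := Finset.sum_nonneg fun i _ => sq_nonneg _
  refine le_trans ?_ (mul_le_mul_of_nonneg_left h3 (by positivity))
  rcases Nat.eq_zero_or_pos (J \ B).card with h0 | hpos
  · have : E = ∅ := by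
      rw [Finset.card_eq_zero] at h0
      exact Finset.subset_empty.1 (h0 ▸ hE)
    rw [this, Finset.sum_empty]
    positivity
  · have hs0 : 0 < s := hpos.trans_le hFs
    have hq : (0 : ℝ) < (J \ B).card := by exact_mod_cast hpos
    have hs0' : (0 : ℝ) < s := by exact_mod_cast hs0
    have h4 : ∑ i ∈ E, z i ^ 2 ≤ ((J.card - s : ℕ) : ℝ) / (J \ B).card * ∑ i ∈ J \ B, z i ^ 2 := by
      rw [div_mul_eq_mul_div, le_div_iff₀ hq]; linarith
    refine h4.trans (mul_le_mul_of_nonneg_right ?_ h30)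
    rw [div_le_div_iff₀ hq hs0']
    -- With `x = J.card - s` and `y = s - (J \ B).card` one has `x + y ≤ sstar`, so `x s ≤ (sstar -
    -- y) s ≤ sstar (s - y)`.
    have h5 : (J.card - s) * s ≤ sstar * (J \ B).card := by
      rcases Nat.lt_or_ge J.card s with hlt | hge
      · rw [Nat.sub_eq_zero_of_le hlt.le]; simp
      · obtain ⟨x, hx⟩ := Nat.exists_eq_add_of_le hge
        obtain ⟨y, hy⟩ := Nat.exists_eq_add_of_le hFs
        obtain ⟨d, hd⟩ := Nat.exists_eq_add_of_le hs
        have hxs : x + y ≤ sstar := by omega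
        rw [hx, Nat.add_sub_cancel_left]
        zify at *
        nlinarith
    exact_mod_cast h5

lemma lossOn_add (X : Matrix (Fin p) (Fin n) ℝ) (y : Fin n → ℝ) (S : Finset (Fin n))
    (θ d : Fin p → ℝ) :
    lossOn X y S (θ + d) =
      lossOn X y S θ + 2 * ∑ a, gradOn X y S θ a * d a + ∑ i ∈ S, (Xᵀ *ᵥ d) i ^ 2 := by
  have h1 : ∑ a, gradOn X y S θ a * d a = ∑ i ∈ S, ((Xᵀ *ᵥ θ) i - y i) * (Xᵀ *ᵥ d) i := by
    simp only [gradOn, Finset.sum_mul]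
    rw [Finset.sum_comm]
    refine Finset.sum_congr rfl fun i _ => ?_
    simp only [Matrix.mulVec, dotProduct, Matrix.transpose_apply, Finset.mul_sum]
    exact Finset.sum_congr rfl fun a _ => by ring
  rw [h1]
  simp only [lossOn, residual, Matrix.mulVec_add, Pi.sub_apply, Pi.add_apply, Finset.mul_sum]
  rw [← Finset.sum_add_distrib, ← Finset.sum_add_distrib]
  exact Finset.sum_congr rfl fun i _ => by ring

/-- Here `D` is the squared distance to the target, `G` the squared gradient on the joint support
and `P` their inner product. Convexity and Cauchy-Schwarz give `A² D ≤ 4 G` and `A gap ≤ G`. The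
choice of `ρ` makes `ρ D ≤ G / (8 Lm²)`, smaller than the gain of about `4 G / (9 Lm²)`. -/
lemma iht_decrease_of_bounds {A Lm ρ D G P gap Q : ℝ} (hA : 0 < A) (hALm : A ≤ Lm)
    (hρ0 : 0 ≤ ρ) (hρ : 32 * Lm ^ 2 * ρ ≤ A ^ 2) (hD : 0 ≤ D) (hG : 0 ≤ G)
    (hP : P ^ 2 ≤ G * D) (hgap : 0 ≤ gap) (hconv : A * D + gap ≤ 2 * P)
    (hQ : Q ≤ -(2 / (3 * Lm)) ^ 2 * G + ρ * (D - 2 * (2 / (3 * Lm)) * P + (2 / (3 * Lm)) ^ 2 * G)) :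
    3 * Lm / 2 * Q ≤ -(A / (12 * Lm)) * gap := by
  have hLm : 0 < Lm := hA.trans_le hALm
  have hP0 : 0 ≤ P := by nlinarith [mul_nonneg hA.le hD]
  have h1 : A ^ 2 * D ≤ 4 * G := by
    rcases hD.eq_or_lt with rfl | hD'
    · simpa using hG
    · have : (A * D) ^ 2 ≤ (2 * P) ^ 2 := by
        apply pow_le_pow_left₀ (by positivity); linarith
      nlinarith
  have h2 : A * gap ≤ G := by
    have h3 : 2 * A * P ≤ A ^ 2 * D + G := by
      refine abs_le_of_sq_le_sq' (a := 2 * A * P) ?_ (by positivity) |>.2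
      nlinarith [sq_nonneg (A ^ 2 * D - G), mul_le_mul_of_nonneg_left hP (sq_nonneg A)]
    nlinarith
  have h4 : 8 * Lm ^ 2 * (ρ * D) ≤ G := by
    have := mul_le_mul_of_nonneg_right hρ hD
    nlinarith
  have h5 : ρ ≤ 1 / 32 := by
    have : A ^ 2 ≤ Lm ^ 2 := by gcongr
    have : Lm ^ 2 * (32 * ρ - 1) ≤ 0 := by nlinarith
    have hL2 : 0 < Lm ^ 2 := by positivity
    by_contra! hlt
    nlinarith
  have h6 : Q ≤ ρ * D - (1 - ρ) * ((2 / (3 * Lm)) ^ 2 * G) := by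
    have : 0 ≤ ρ * (2 * (2 / (3 * Lm)) * P) := by positivity
    nlinarith
  have h7 : Lm ^ 2 * ((2 / (3 * Lm)) ^ 2 * G) = 4 / 9 * G := by field_simp; ring
  have h8 : Lm ^ 2 * Q ≤ -(1 / 18) * G := by
    have hL2 : 0 < Lm ^ 2 := by positivity
    have h9 := mul_le_mul_of_nonneg_left h6 hL2.le
    have h10 : Lm ^ 2 * (ρ * D - (1 - ρ) * ((2 / (3 * Lm)) ^ 2 * G)) =
        Lm ^ 2 * (ρ * D) - (1 - ρ) * (4 / 9 * G) := by rw [← h7]; ring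
    nlinarith
  have h11 : 12 * Lm * (3 * Lm / 2 * Q) ≤ -(A * gap) := by nlinarith
  have h12 : -(A / (12 * Lm)) * gap = -(A * gap) / (12 * Lm) := by ring
  rw [h12, le_div_iff₀ (by positivity)]
  linarith

/-- One step of iterative hard thresholding contracts the excess loss. -/
theorem IsSparseProj.lossOn_le {X : Matrix (Fin p) (Fin n) ℝ} {y : Fin n → ℝ}
    {S : Finset (Fin n)} {s sstar : ℕ} {A Lm : ℝ} (hA : 0 < A) (hALm : A ≤ Lm)
    (hs : 32 * (Lm / A) ^ 2 * sstar ≤ s)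
    (hlow : ∀ u v : Fin p → ℝ, hammingNorm u ≤ s → hammingNorm v ≤ s + sstar →
      A * l2 (u - v) ^ 2 ≤ ∑ i ∈ S, (Xᵀ *ᵥ (u - v)) i ^ 2)
    (hup : ∀ u v : Fin p → ℝ, hammingNorm u ≤ s → hammingNorm v ≤ s + sstar →
      ∑ i ∈ S, (Xᵀ *ᵥ (u - v)) i ^ 2 ≤ Lm * l2 (u - v) ^ 2)
    {θ θ' u : Fin p → ℝ} (hθ : hammingNorm θ ≤ s) (hθ' : hammingNorm θ' ≤ sstar)
    (hu : IsSparseProj s (θ - (2 / (3 * Lm)) • gradOn X y S θ) u) :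
    lossOn X y S u ≤ lossOn X y S θ ∧ (lossOn X y S θ' ≤ lossOn X y S θ →
      lossOn X y S u - lossOn X y S θ' ≤
        (1 - A / (12 * Lm)) * (lossOn X y S θ - lossOn X y S θ')) := by
  classical
  have hLm : 0 < Lm := hA.trans_le hALm
  have hsR : 32 * Lm ^ 2 * (sstar : ℝ) ≤ A ^ 2 * s := by
    rw [div_pow] at hs
    have := mul_le_mul_of_nonneg_left hs (sq_nonneg A)
    have h2 : A ^ 2 * (32 * (Lm ^ 2 / A ^ 2) * (sstar : ℝ)) = 32 * Lm ^ 2 * sstar := by field_simp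
    linarith
  have hss : sstar ≤ s := by
    have h1 : A ^ 2 ≤ Lm ^ 2 := by gcongr
    have h2 : A ^ 2 * (sstar : ℝ) ≤ A ^ 2 * s := by
      refine le_trans ?_ hsR
      have : (0 : ℝ) ≤ sstar := Nat.cast_nonneg _
      nlinarith
    exact_mod_cast le_of_mul_le_mul_left h2 (by positivity : 0 < A ^ 2)
  set h := 2 / (3 * Lm) with hh
  have hh0 : 0 < h := by positivity
  set g := gradOn X y S θ with hg
  have hinv : 3 * Lm / 2 * h = 1 := by rw [hh]; field_simp
  have hsm := hup u θ hu.1 (hθ.trans (Nat.le_add_right _ _))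
  have hF1 := lossOn_add X y S θ (u - θ)
  rw [add_sub_cancel] at hF1
  set Q := l2 (u - θ) ^ 2 + 2 * h * ∑ a, g a * (u - θ) a with hQ
  have hF2 : lossOn X y S u - lossOn X y S θ ≤ 3 * Lm / 2 * Q := by
    rw [hF1, hQ, mul_add, show 3 * Lm / 2 * (2 * h * ∑ a, g a * (u - θ) a) =
      (3 * Lm / 2 * h) * (2 * ∑ a, g a * (u - θ) a) by ring, hinv]
    nlinarith [sq_nonneg (l2 (u - θ))]
  have hexp : ∑ i, ((θ - h • g) i - u i) ^ 2 = Q + h ^ 2 * ∑ a, g a ^ 2 := by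
    rw [hQ, l2_sq, Finset.mul_sum, Finset.mul_sum, ← Finset.sum_add_distrib,
      ← Finset.sum_add_distrib]
    refine Finset.sum_congr rfl fun i _ => ?_
    simp only [Pi.sub_apply, Pi.smul_apply, smul_eq_mul]
    ring
  constructor
  · have h1 := pow_le_pow_left₀ (l2_nonneg _) (hu.2 θ hθ) 2
    rw [l2_sq, l2_sq] at h1
    have h2 : ∑ i, ((θ - h • g) i - u i) ^ 2 ≤ h ^ 2 * ∑ a, g a ^ 2 := by
      refine h1.trans (le_of_eq ?_)
      rw [Finset.mul_sum]
      refine Finset.sum_congr rfl fun i _ => ?_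
      simp only [Pi.sub_apply, Pi.smul_apply, smul_eq_mul]
      ring
    have : Q ≤ 0 := by linarith
    nlinarith
  · intro hge
    have hF3 := lossOn_add X y S θ (θ' - θ)
    rw [add_sub_cancel] at hF3
    have hsc := hlow θ θ' hθ (hθ'.trans (Nat.le_add_left _ _))
    set J := Finset.univ.filter fun i => θ i ≠ 0 ∨ θ' i ≠ 0 with hJ
    have hz : ∀ i ∉ J, θ i = 0 ∧ θ' i = 0 := by
      intro i hi
      simpa [hJ, not_or] using hi
    have hproj := hu.sum_sq_le hθ hθ' hss hJ
    have hJsum : ∑ a, g a * (θ' - θ) a = ∑ a ∈ J, g a * (θ' - θ) a := by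
      symm
      refine Finset.sum_subset (Finset.subset_univ _) fun i _ hi => ?_
      simp [hz i hi]
    have hJd : l2 (θ - θ') ^ 2 = ∑ a ∈ J, (θ a - θ' a) ^ 2 := by
      rw [l2_sq]
      symm
      refine Finset.sum_subset (Finset.subset_univ _) fun i _ hi => ?_
      simp [hz i hi]
    have hneg : ∑ i ∈ S, (Xᵀ *ᵥ (θ' - θ)) i ^ 2 = ∑ i ∈ S, (Xᵀ *ᵥ (θ - θ')) i ^ 2 := by
      rw [← neg_sub θ θ', Matrix.mulVec_neg]
      simp
    set P := -∑ a ∈ J, g a * (θ' - θ) a with hP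
    set G := ∑ a ∈ J, g a ^ 2 with hG
    have hPG : P ^ 2 ≤ G * l2 (θ - θ') ^ 2 := by
      have hd : ∑ i ∈ J, (θ' - θ) i ^ 2 = ∑ i ∈ J, (θ i - θ' i) ^ 2 :=
        Finset.sum_congr rfl fun i _ => by simp only [Pi.sub_apply]; ring
      rw [hP, neg_sq, hJd, ← hd]
      exact Finset.sum_mul_sq_le_sq_mul_sq _ _ _
    have hE1 : ∑ i ∈ Jᶜ, (θ - h • g) i ^ 2 + h ^ 2 * G = h ^ 2 * ∑ a, g a ^ 2 := by
      have hc : ∑ i ∈ Jᶜ, (θ - h • g) i ^ 2 = h ^ 2 * ∑ i ∈ Jᶜ, g i ^ 2 := by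
        rw [Finset.mul_sum]
        refine Finset.sum_congr rfl fun i hi => ?_
        simp only [Pi.sub_apply, Pi.smul_apply, smul_eq_mul, (hz i (Finset.mem_compl.1 hi)).1]
        ring
      rw [hc, ← Finset.sum_compl_add_sum J (fun a => g a ^ 2), mul_add]
    have hE2 : ∑ i ∈ J, ((θ - h • g) i - θ' i) ^ 2 =
        l2 (θ - θ') ^ 2 - 2 * h * P + h ^ 2 * G := by
      rw [hJd, hP, hG, mul_neg, sub_neg_eq_add, Finset.mul_sum, Finset.mul_sum,
        ← Finset.sum_add_distrib, ← Finset.sum_add_distrib]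
      refine Finset.sum_congr rfl fun i _ => ?_
      simp only [Pi.sub_apply, Pi.smul_apply, smul_eq_mul]
      ring
    rw [hexp, hE2] at hproj
    have hρ : 32 * Lm ^ 2 * ((sstar : ℝ) / s) ≤ A ^ 2 := by
      rcases Nat.eq_zero_or_pos s with h0 | hpos
      · simp only [h0, Nat.cast_zero, div_zero, mul_zero]; positivity
      · rw [← mul_div_assoc, div_le_iff₀ (by exact_mod_cast hpos)]
        exact hsR
    have hdec := iht_decrease_of_bounds (ρ := (sstar : ℝ) / s) (D := l2 (θ - θ') ^ 2) (G := G)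
      (P := P) (gap := lossOn X y S θ - lossOn X y S θ') (Q := Q) hA hALm (by positivity) hρ
      (sq_nonneg _) (Finset.sum_nonneg fun i _ => sq_nonneg _) hPG (by linarith)
      (by rw [hJsum, hneg] at hF3; linarith) (by linarith)
    linarith

/-- Accuracy of iterative hard thresholding started at `0`. -/
theorem IHTUpdate.lossOn_le {X : Matrix (Fin p) (Fin n) ℝ} {y : Fin n → ℝ}
    {S : Finset (Fin n)} {s sstar τ : ℕ} {A Lm : ℝ} (hA : 0 < A) (hALm : A ≤ Lm)
    (hs : 32 * (Lm / A) ^ 2 * sstar ≤ s)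
    (hlow : ∀ u v : Fin p → ℝ, hammingNorm u ≤ s → hammingNorm v ≤ s + sstar →
      A * l2 (u - v) ^ 2 ≤ ∑ i ∈ S, (Xᵀ *ᵥ (u - v)) i ^ 2)
    (hup : ∀ u v : Fin p → ℝ, hammingNorm u ≤ s → hammingNorm v ≤ s + sstar →
      ∑ i ∈ S, (Xᵀ *ᵥ (u - v)) i ^ 2 ≤ Lm * l2 (u - v) ^ 2)
    {θ' w' : Fin p → ℝ} (hθ' : hammingNorm θ' ≤ sstar)
    (hw : IHTUpdate X y s (2 / (3 * Lm)) τ S w') :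
    hammingNorm w' ≤ s ∧
      lossOn X y S w' ≤ lossOn X y S θ' + Real.exp (-(τ * (A / (12 * Lm)))) * l2 y ^ 2 := by
  obtain ⟨u, hu0, hstep, rfl⟩ := hw
  have hLm : 0 < Lm := hA.trans_le hALm
  have hsp : ∀ j, hammingNorm (u j) ≤ s := by
    rintro (_ | j)
    · simp [hu0]
    · exact (hstep j).1
  refine ⟨hsp τ, ?_⟩
  set c := A / (12 * Lm) with hc
  have hc1 : 0 ≤ 1 - c := by
    rw [hc, sub_nonneg, div_le_one (by positivity)]; linarith
  have hexp : 1 - c ≤ Real.exp (-c) := by linarith [Real.add_one_le_exp (-c)]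
  have hE : ∀ j : ℕ, Real.exp (-((j + 1 : ℕ) * c)) = Real.exp (-c) * Real.exp (-(j * c)) := by
    intro j
    rw [← Real.exp_add]; congr 1; push_cast; ring
  induction τ with
  | zero =>
    have h1 : lossOn X y S (u 0) ≤ l2 y ^ 2 := by
      simpa [lossOn, residual, hu0] using sum_sq_le_l2_sq y S
    have h2 : 0 ≤ lossOn X y S θ' := Finset.sum_nonneg fun i _ => sq_nonneg _
    simp only [Nat.cast_zero, zero_mul, neg_zero, Real.exp_zero]
    linarith
  | succ j ih =>
    obtain ⟨hmono, hcontr⟩ := (hstep j).lossOn_le hA hALm hs hlow hup (hsp j) hθ'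
    have hpos : 0 ≤ Real.exp (-((j + 1 : ℕ) * c)) * l2 y ^ 2 := by positivity
    -- The target need not minimize the loss over `s`-sparse vectors, so an iterate may beat it;
    -- from then on monotonicity replaces contraction.
    rcases le_or_gt (lossOn X y S θ') (lossOn X y S (u j)) with hge | hlt
    · have h1 := hcontr hge
      have h2 : (1 - c) * (lossOn X y S (u j) - lossOn X y S θ') ≤
          Real.exp (-c) * (Real.exp (-(j * c)) * l2 y ^ 2) :=
        mul_le_mul hexp (by linarith) (by linarith) (Real.exp_pos _).le
      rw [hE, mul_assoc]
      linarith
    · linarith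

end IterativeHardThresholding

/-! ### Fixed design guarantees. -/

section FixedDesign

variable {p n : ℕ}

lemma l2_le_of_rootOf_le {M : Matrix (Fin p) (Fin p) ℝ} (hM : M.PosDef) (hp : 0 < p)
    {v : Fin p → ℝ} {B : ℝ} (h : l2 (rootOf M *ᵥ v) ≤ B) : l2 v ≤ B / √(lamMin M) := by
  have hl := lamMin_pos hM hp
  have h1 : √(lamMin M) * l2 v ≤ l2 (rootOf M *ᵥ v) := by
    refine abs_le_of_sq_le_sq' (a := √(lamMin M) * l2 v) ?_ (l2_nonneg _) |>.2
    rw [mul_pow, Real.sq_sqrt hl.le]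
    exact lamMin_mul_le hM v
  rw [le_div_iff₀ (Real.sqrt_pos.2 hl)]
  linarith

/-- If the updates are accurate up to `e`, TORRENT converges linearly under restricted strong
convexity and smoothness. -/
theorem IsTorrentRun.l2_le {X : Matrix (Fin p) (Fin n) ℝ} {M : Matrix (Fin p) (Fin p) ℝ}
    (hM : M.PosDef) {sstar s : ℕ} {α β a L e : ℝ} (hαβ : α ≤ β) (hβ0 : 0 ≤ β) (hβ1 : β < 1)
    (ha : 0 < a) (he : 0 ≤ e)
    (hC : SRSC ((rootOf M)⁻¹ * X) (rootOf M) (keepCount β n) (s + sstar) a)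
    (hS : SRSS ((rootOf M)⁻¹ * X) (rootOf M) (dropCount β n) (s + sstar) L)
    (hη : 4 * L / a < 1) {wstar : Fin p → ℝ} {b : Fin n → ℝ} (hws : hammingNorm wstar ≤ sstar)
    (hb : (hammingNorm b : ℝ) ≤ α * n)
    {U : Finset (Fin n) → (Fin p → ℝ) → Prop}
    (hU : ∀ S w', keepCount β n ≤ S.card → U S w' → hammingNorm w' ≤ s ∧
      lossOn X (output X wstar b) S w' ≤ lossOn X (output X wstar b) S wstar + e)
    {w : ℕ → Fin p → ℝ} {S : ℕ → Finset (Fin n)}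
    (hrun : IsTorrentRun X (output X wstar b) (keepCount β n) U w S)
    {ε₁ ε₂ : ℝ} (hε₁ : 0 < ε₁) (hε₂ : 0 ≤ ε₂)
    (hacc : 0 ≤ L → 0 < p → √(e / a) / (1 - 4 * L / a) ≤ ε₂ * √(lamMin M))
    {t : ℕ} (ht : 1 ≤ t)
    (ht' : 1 + Real.log (2 * √(n * L / lamMin M) / a * (1 / √n * (l2 b / ε₁))) /
      Real.log (1 / (4 * L / a)) ≤ t) :
    l2 (w t - wstar) ≤ ε₁ + ε₂ := by
  obtain ⟨t, rfl⟩ := Nat.exists_eq_add_of_le' ht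
  rcases Nat.eq_zero_or_pos p with rfl | hp
  · rw [Subsingleton.elim (w (t + 1) - wstar) 0, l2_zero]
    linarith
  have hkn := dropCount_le (n := n) hβ0 hβ1
  have hmk := keepCount_add_dropCount (n := n) hβ0 hβ1
  have hcard : keepCount β n ≤ (S t).card := by
    cases t with
    | zero => rw [hrun.2.1, Finset.card_univ, Fintype.card_fin]; omega
    | succ t => rw [(hrun.2.2 t).2.card (by omega)]
  have hsp : hammingNorm (w (t + 1)) ≤ s := (hU _ _ hcard (hrun.2.2 t).1).1
  -- A negative `L`, tested on the empty index set, forces exact recovery.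
  rcases lt_or_ge L 0 with hL | hL
  · have h1 := hS.sum_le hM rfl hsp hws (S := ∅) (by simp) hkn
    rw [Finset.sum_empty] at h1
    have h2 : l2 (rootOf M *ᵥ (w (t + 1) - wstar)) = 0 := by
      by_contra hne
      have : 0 < l2 (rootOf M *ᵥ (w (t + 1) - wstar)) ^ 2 := by positivity
      nlinarith
    rw [l2_rootOf_eq_zero hM h2, l2_zero]
    linarith
  have hl := lamMin_pos hM hp
  have hsl : 0 < √(lamMin M) := Real.sqrt_pos.2 hl
  have herr := hrun.error_le hmk ha hL he hη (R := rootOf M) (s := s)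
    (fun v hv T hT => hC.le_sum hM rfl hv hws hT)
    (fun v hv T hT => hS.sum_le hM rfl hv hws hT hkn)
    (hammingNorm_le_dropCount hαβ hb) hU t
  have h1 := l2_le_of_rootOf_le hM hp herr
  rw [add_div] at h1
  have h2 : √(e / a) / (1 - 4 * L / a) / √(lamMin M) ≤ ε₂ := by
    rw [div_le_iff₀ hsl]; exact hacc hL hp
  refine h1.trans (add_le_add ?_ h2)
  rcases Nat.eq_zero_or_pos n with rfl | hn
  · have : l2 b = 0 := by rw [Subsingleton.elim b 0, l2_zero]
    simp [this, hε₁.le]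
  have hn' : (0 : ℝ) < n := by exact_mod_cast hn
  have hD : 2 * √(n * L / lamMin M) / a * (1 / √n * (l2 b / ε₁)) =
      2 * √L / a * l2 b / √(lamMin M) / ε₁ := by
    rw [mul_div_assoc (n : ℝ), Real.sqrt_mul hn'.le, Real.sqrt_div hL]
    have : 0 < √(n : ℝ) := Real.sqrt_pos.2 hn'
    field_simp
  rw [hD] at ht'
  rw [mul_div_assoc]
  refine pow_mul_le_of_log_le (by positivity) hη ?_ hε₁ ?_ (by exact_mod_cast ht')
  · have := l2_nonneg b
    positivity
  · intro h0
    have : L = 0 := by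
      rcases div_eq_zero_iff.1 h0 with h | h <;> linarith
    simp [this]

theorem exact_update_fixed_design {X : Matrix (Fin p) (Fin n) ℝ}
    {M : Matrix (Fin p) (Fin p) ℝ} (hM : M.PosDef) {sstar s : ℕ} {α β a L : ℝ} (hαβ : α ≤ β)
    (hβ0 : 0 ≤ β) (hβ1 : β < 1) (hss : sstar ≤ s) (ha : 0 < a)
    (hC : SRSC ((rootOf M)⁻¹ * X) (rootOf M) (keepCount β n) (s + sstar) a)
    (hS : SRSS ((rootOf M)⁻¹ * X) (rootOf M) (dropCount β n) (s + sstar) L)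
    (hη : 4 * L / a < 1) {wstar : Fin p → ℝ} {b : Fin n → ℝ} (hws : hammingNorm wstar ≤ sstar)
    (hb : (hammingNorm b : ℝ) ≤ α * n) {w : ℕ → Fin p → ℝ} {S : ℕ → Finset (Fin n)}
    (hrun : IsTorrentRun X (output X wstar b) (keepCount β n)
      (SparseLSUpdate X (output X wstar b) s) w S)
    {ε : ℝ} (hε : 0 < ε) {t : ℕ} (ht : 1 ≤ t)
    (ht' : 1 + Real.log (2 * √(n * L / lamMin M) / a * (1 / √n * (l2 b / ε))) /
      Real.log (1 / (4 * L / a)) ≤ t) :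
    l2 (w t - wstar) ≤ ε := by
  have := hrun.l2_le hM hαβ hβ0 hβ1 ha le_rfl hC hS hη hws hb
    (fun T w' _ hw' => ⟨hw'.1, by simpa using hw'.2 wstar (hws.trans hss)⟩) hε le_rfl
    (by simp) ht ht'
  simpa using this

theorem iht_update_fixed_design {X : Matrix (Fin p) (Fin n) ℝ}
    {M : Matrix (Fin p) (Fin p) ℝ} (hM : M.PosDef) {sstar s : ℕ} {α β a L a₂ L₂ : ℝ}
    (hαβ : α ≤ β) (hβ0 : 0 ≤ β) (hβ1 : β < 1) (ha : 0 < a) (ha₂ : 0 < a₂)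
    (hC₂ : SRSC ((rootOf M)⁻¹ * X) (rootOf M) (keepCount β n) (2 * s + sstar) a₂)
    (hS₂ : SRSS ((rootOf M)⁻¹ * X) (rootOf M) n (2 * s + sstar) L₂)
    (hs : 32 * (condNum M * (L₂ / a₂)) ^ 2 * sstar ≤ s)
    (hC : SRSC ((rootOf M)⁻¹ * X) (rootOf M) (keepCount β n) (s + sstar) a)
    (hS : SRSS ((rootOf M)⁻¹ * X) (rootOf M) (dropCount β n) (s + sstar) L)
    (hη : 4 * L / a < 1) {wstar : Fin p → ℝ} {b : Fin n → ℝ} (hws : hammingNorm wstar ≤ sstar)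
    (hb : (hammingNorm b : ℝ) ≤ α * n) {ε : ℝ} (hε : 0 < ε) {τ : ℕ}
    (hτ : 12 * (condNum M * (L₂ / a₂)) * Real.log (4 * l2 (output X wstar b) ^ 2 /
      ((1 - 4 * L / a) ^ 2 * lamMin M * a * ε ^ 2)) ≤ τ)
    {w : ℕ → Fin p → ℝ} {S : ℕ → Finset (Fin n)}
    (hrun : IsTorrentRun X (output X wstar b) (keepCount β n)
      (IHTUpdate X (output X wstar b) s (2 / (3 * (lamMax M * L₂))) τ) w S)
    {t : ℕ} (ht : 1 ≤ t)
    (ht' : 1 + Real.log (4 * √(n * L / lamMin M) / a * (1 / √n * (l2 b / ε))) /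
      Real.log (1 / (4 * L / a)) ≤ t) :
    l2 (w t - wstar) ≤ ε := by
  rcases Nat.eq_zero_or_pos p with rfl | hp
  · rw [Subsingleton.elim (w t - wstar) 0, l2_zero]
    exact hε.le
  have hl := lamMin_pos hM hp
  have hlM := hl.trans_le (lamMin_le_lamMax hM)
  -- At sparsity level zero the properties say nothing about `a₂` and `L₂`, but all vectors involved
  -- vanish. Otherwise a coordinate vector shows `a₂ ≤ L₂`.
  rcases Nat.eq_zero_or_pos (2 * s + sstar) with h0 | hr
  · obtain ⟨t, rfl⟩ := Nat.exists_eq_add_of_le' ht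
    obtain ⟨u, hu0, hstep, hw⟩ := (hrun.2.2 t).1
    have h1 : w (t + 1) = 0 := by
      cases τ with
      | zero => rw [hw, hu0]
      | succ τ =>
        rw [hw]
        exact hammingNorm_eq_zero.1 (Nat.le_zero.1 ((hstep τ).1.trans (by omega)))
    have h2 : wstar = 0 := hammingNorm_eq_zero.1 (by omega)
    rw [h1, h2, sub_zero, l2_zero]
    exact hε.le
  have hL₂ : a₂ ≤ L₂ := by
    let v : Fin p → ℝ := Pi.single ⟨0, hp⟩ 1
    have hv : v ≠ 0 := by simp [v]
    have hv1 : hammingNorm v ≤ 2 * s + sstar :=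
      (hammingNorm_le_card_of_support (J := {⟨0, hp⟩}) fun i hi => by
        simpa [v] using Pi.single_eq_of_ne (M := fun _ => ℝ) (by simpa using hi) 1).trans
        hr
    have h1 := hC₂.le_sum hM (add_zero _) hv1 (w := 0) (by simp) (S := Finset.univ)
      (by simp [keepCount])
    have h2 := hS₂.sum_le hM (add_zero _) hv1 (w := 0) (by simp) (S := Finset.univ)
      (by simp) le_rfl
    have h3 : 0 < l2 (rootOf M *ᵥ (v - 0)) ^ 2 := by
      have := l2_nonneg (rootOf M *ᵥ (v - 0))
      have hne : l2 (rootOf M *ᵥ (v - 0)) ≠ 0 := fun h => by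
        have := l2_rootOf_eq_zero hM h
        exact hv (by simpa using this)
      positivity
    exact le_of_mul_le_mul_right (h1.trans h2) h3
  have hL₂0 := ha₂.trans_le hL₂
  set κ := condNum M * (L₂ / a₂) with hκ
  have hκ' : lamMax M * L₂ / (lamMin M * a₂) = κ := by
    rw [hκ, condNum]; field_simp
  have hκ0 : 0 < κ := by rw [← hκ']; positivity
  set y := output X wstar b with hy
  set e := Real.exp (-(τ * (lamMin M * a₂ / (12 * (lamMax M * L₂))))) * l2 y ^ 2 with he
  have he0 : 0 ≤ e := by positivity
  have hτκ : (τ : ℝ) * (lamMin M * a₂ / (12 * (lamMax M * L₂))) = τ / (12 * κ) := by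
    rw [← hκ']; field_simp
  have hlow : ∀ T : Finset (Fin n), keepCount β n ≤ T.card → ∀ u v : Fin p → ℝ,
      hammingNorm u ≤ s → hammingNorm v ≤ s + sstar →
      lamMin M * a₂ * l2 (u - v) ^ 2 ≤ ∑ i ∈ T, (Xᵀ *ᵥ (u - v)) i ^ 2 := by
    intro T hT u v hu hv
    refine le_trans ?_ (hC₂.le_sum hM (by omega) hu hv hT)
    nlinarith [lamMin_mul_le hM (u - v)]
  have hup : ∀ T : Finset (Fin n), ∀ u v : Fin p → ℝ,
      hammingNorm u ≤ s → hammingNorm v ≤ s + sstar →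
      ∑ i ∈ T, (Xᵀ *ᵥ (u - v)) i ^ 2 ≤ lamMax M * L₂ * l2 (u - v) ^ 2 := by
    intro T u v hu hv
    refine le_trans (hS₂.sum_le hM (by omega) hu hv (by simpa using T.card_le_univ) le_rfl) ?_
    nlinarith [le_lamMax_mul hM (u - v)]
  -- Half of `ε` goes to the inexact updates, half to the outer iteration; hence the `4` in the
  -- bound on `τ` and the doubled constant in the bound on `t`.
  have hacc : 0 ≤ L → 0 < p → √(e / a) / (1 - 4 * L / a) ≤ ε / 2 * √(lamMin M) := by
    intro _ _
    have hden : 0 < 1 - 4 * L / a := by linarith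
    rw [div_le_iff₀ hden]
    refine Real.sqrt_le_iff.2 ⟨by positivity, ?_⟩
    rw [mul_pow, mul_pow, Real.sq_sqrt hl.le, div_le_iff₀ ha]
    rcases (l2_nonneg y).eq_or_lt with h0 | hy0
    · rw [he, ← h0]
      simp only [ne_eq, OfNat.ofNat_ne_zero, not_false_eq_true, zero_pow, mul_zero]
      positivity
    · have hQ : 0 < (1 - 4 * L / a) ^ 2 * lamMin M * a * ε ^ 2 := by positivity
      have h1 : Real.log (4 * l2 y ^ 2 / ((1 - 4 * L / a) ^ 2 * lamMin M * a * ε ^ 2)) ≤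
          τ / (12 * κ) := by
        rw [le_div_iff₀ (by positivity)]; linarith
      rw [Real.log_le_iff_le_exp (by positivity), div_le_iff₀ hQ] at h1
      rw [he, hτκ, Real.exp_neg, inv_mul_le_iff₀ (Real.exp_pos _)]
      nlinarith
  have hmain := hrun.l2_le hM hαβ hβ0 hβ1 ha he0 hC hS hη hws hb
    (fun T w' hT hw' => hw'.lossOn_le (by positivity)
      (mul_le_mul (lamMin_le_lamMax hM) hL₂ ha₂.le hlM.le) (by rwa [hκ']) (hlow T hT) (hup T) hws)
    (half_pos hε) (half_pos hε).le hacc ht (by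
      convert ht' using 4
      ring)
  linarith

end FixedDesign

/-! ### Nets of the unit ball and operator bounds. -/

section Nets

/-- A largest 1-separated set in the ball of radius 2 covers that ball at distance 1; scaling by one
half gives the net. -/
lemma exists_half_net (E : Type*) [NormedAddCommGroup E] [NormedSpace ℝ E]
    [FiniteDimensional ℝ E] : ∃ T : Finset E, T.card ≤ 5 ^ Module.finrank ℝ E ∧
      ∀ x : E, ‖x‖ ≤ 1 → ∃ c ∈ T, ‖x - c‖ ≤ 1 / 2 := by
  classical
  let P : Finset E → Prop := fun T => (∀ c ∈ T, ‖c‖ ≤ 2) ∧ ∀ c ∈ T, ∀ d ∈ T, c ≠ d → 1 ≤ ‖c - d‖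
  have hbdd : BddAbove {k | ∃ T : Finset E, T.card = k ∧ P T} :=
    ⟨5 ^ Module.finrank ℝ E, by
      rintro k ⟨T, rfl, hT⟩
      exact Besicovitch.card_le_of_separated T hT.1 hT.2⟩
  obtain ⟨T, hTc, hT⟩ := Nat.sSup_mem (s := {k | ∃ T : Finset E, T.card = k ∧ P T})
    ⟨0, ∅, by simp [P]⟩ hbdd
  have hcover : ∀ x : E, ‖x‖ ≤ 2 → ∃ c ∈ T, ‖x - c‖ ≤ 1 := by
    intro x hx
    by_contra! hfar
    have hxT : x ∉ T := fun h => by have := hfar x h; simp at this; linarith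
    have hP : P (insert x T) := by
      refine ⟨fun c hc => ?_, fun c hc d hd hne => ?_⟩
      · rcases Finset.mem_insert.1 hc with rfl | hc
        · exact hx
        · exact hT.1 c hc
      · rcases Finset.mem_insert.1 hc with rfl | hc' <;>
          rcases Finset.mem_insert.1 hd with rfl | hd'
        · exact absurd rfl hne
        · exact (hfar d hd').le
        · rw [norm_sub_rev]; exact (hfar c hc').le
        · exact hT.2 c hc' d hd' hne
    have hle := le_csSup hbdd ⟨insert x T, rfl, hP⟩
    rw [Finset.card_insert_of_notMem hxT] at hle
    omega
  refine ⟨T.image fun c => (1 / 2 : ℝ) • c, Finset.card_image_le.trans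
    (Besicovitch.card_le_of_separated T hT.1 hT.2), fun x hx => ?_⟩
  obtain ⟨c, hc, hxc⟩ := hcover ((2 : ℝ) • x) (by rw [norm_smul]; simp; linarith)
  refine ⟨_, Finset.mem_image_of_mem _ hc, ?_⟩
  have : x - (1 / 2 : ℝ) • c = (1 / 2 : ℝ) • ((2 : ℝ) • x - c) := by
    rw [smul_sub, smul_smul]; norm_num
  rw [this, norm_smul, Real.norm_of_nonneg (by norm_num)]
  linarith

lemma exists_dyadic_net (E : Type*) [NormedAddCommGroup E] [NormedSpace ℝ E]
    [FiniteDimensional ℝ E] (j : ℕ) : ∃ T : Finset E, T.card ≤ 5 ^ (j * Module.finrank ℝ E) ∧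
      ∀ x : E, ‖x‖ ≤ 1 → ∃ c ∈ T, ‖x - c‖ ≤ (1 / 2) ^ j := by
  classical
  induction j with
  | zero => exact ⟨{0}, by simp, fun x hx => ⟨0, by simp, by simpa using hx⟩⟩
  | succ j ih =>
    obtain ⟨T, hTc, hT⟩ := ih
    obtain ⟨N, hNc, hN⟩ := exists_half_net E
    refine ⟨(T ×ˢ N).image fun z => z.1 + ((1 / 2 : ℝ) ^ j) • z.2, ?_, fun x hx => ?_⟩
    · refine Finset.card_image_le.trans ?_
      rw [Finset.card_product, add_mul, one_mul, pow_add]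
      exact Nat.mul_le_mul hTc hNc
    · obtain ⟨c, hc, hxc⟩ := hT x hx
      obtain ⟨d, hd, hxd⟩ := hN (((2 : ℝ) ^ j) • (x - c)) (by
        rw [norm_smul, Real.norm_of_nonneg (by positivity)]
        calc (2 : ℝ) ^ j * ‖x - c‖ ≤ 2 ^ j * (1 / 2) ^ j := by gcongr
          _ = 1 := by rw [← mul_pow]; norm_num)
      refine ⟨c + ((1 / 2 : ℝ) ^ j) • d,
        Finset.mem_image.2 ⟨(c, d), Finset.mem_product.2 ⟨hc, hd⟩, rfl⟩, ?_⟩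
      have h1 : x - (c + ((1 / 2 : ℝ) ^ j) • d) =
          ((1 / 2 : ℝ) ^ j) • (((2 : ℝ) ^ j) • (x - c) - d) := by
        rw [smul_sub, smul_smul, ← mul_pow]
        norm_num
        abel
      rw [h1, norm_smul, Real.norm_of_nonneg (by positivity), pow_succ]
      gcongr

variable {E F : Type*} [NormedAddCommGroup E] [NormedSpace ℝ E]
  [NormedAddCommGroup F] [NormedSpace ℝ F]

/-- The error of replacing `x` by a net point is absorbed as `ε ‖A‖`. Net points may leave the unit
ball, which costs the factor `1 + ε`. -/
lemma norm_le_of_net {T : Finset E} {ε : ℝ} (hε0 : 0 ≤ ε) (hε1 : ε < 1)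
    (hT : ∀ x : E, ‖x‖ ≤ 1 → ∃ c ∈ T, ‖x - c‖ ≤ ε) (A : E →L[ℝ] F) {B : ℝ} (hB : 0 ≤ B)
    (hA : ∀ c ∈ T, ‖A c‖ ≤ B * ‖c‖) : ‖A‖ ≤ B * (1 + ε) / (1 - ε) := by
  have h : ‖A‖ ≤ B * (1 + ε) + ε * ‖A‖ := by
    refine A.opNorm_le_of_unit_norm (by positivity) fun x hx => ?_
    obtain ⟨c, hc, hxc⟩ := hT x hx.le
    have h1 : ‖c‖ ≤ 1 + ε := by
      have := norm_sub_norm_le c x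
      rw [norm_sub_rev] at this
      linarith
    have h2 : A x = A c + A (x - c) := by rw [map_sub]; abel
    calc ‖A x‖ ≤ ‖A c‖ + ‖A (x - c)‖ := h2 ▸ norm_add_le _ _
      _ ≤ B * (1 + ε) + ‖A‖ * ε := by
        refine add_le_add ((hA c hc).trans (by gcongr)) ((A.le_opNorm _).trans (by gcongr))
      _ = B * (1 + ε) + ε * ‖A‖ := by ring
  rw [le_div_iff₀ (by linarith)]
  linarith

lemma le_norm_of_net {T : Finset E} {ε : ℝ} (hε0 : 0 ≤ ε) (hε1 : ε < 1)
    (hT : ∀ x : E, ‖x‖ ≤ 1 → ∃ c ∈ T, ‖x - c‖ ≤ ε) (A : E →L[ℝ] F) {B b : ℝ} (hB : 0 ≤ B)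
    (hb : 0 ≤ b) (hA : ∀ c ∈ T, ‖A c‖ ≤ B * ‖c‖) (hA' : ∀ c ∈ T, b * ‖c‖ ≤ ‖A c‖) (x : E) :
    (b * (1 - ε) - B * (1 + ε) / (1 - ε) * ε) * ‖x‖ ≤ ‖A x‖ := by
  have hunit : ∀ x : E, ‖x‖ = 1 → b * (1 - ε) - B * (1 + ε) / (1 - ε) * ε ≤ ‖A x‖ := by
    intro x hx
    obtain ⟨c, hc, hxc⟩ := hT x hx.le
    have h1 : 1 - ε ≤ ‖c‖ := by
      have := norm_sub_norm_le x c
      linarith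
    have h2 : A c = A x - A (x - c) := by rw [map_sub]; abel
    have h3 : ‖A c‖ ≤ ‖A x‖ + ‖A (x - c)‖ := h2 ▸ norm_sub_le _ _
    have h4 : ‖A (x - c)‖ ≤ B * (1 + ε) / (1 - ε) * ε :=
      (A.le_opNorm _).trans (mul_le_mul (norm_le_of_net hε0 hε1 hT A hB hA) hxc (norm_nonneg _)
        (div_nonneg (by positivity) (by linarith)))
    have h5 := mul_le_mul_of_nonneg_left h1 hb
    linarith [hA' c hc]
  rcases eq_or_ne x 0 with rfl | hx
  · simp
  · have hx' : 0 < ‖x‖ := norm_pos_iff.2 hx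
    have h := hunit (‖x‖⁻¹ • x) (by rw [norm_smul]; simp [hx])
    rw [map_smul, norm_smul, norm_inv, norm_norm, le_inv_mul_iff₀ hx'] at h
    linarith

end Nets

/-! ### Nets of sparse vectors in the weighted norm. -/

section SparseNets

variable {p : ℕ}

/-- The image under `R` of the vectors supported on the range of `f`. -/
def coordSpace (R : Matrix (Fin p) (Fin p) ℝ) {r : ℕ} (f : Fin r → Fin p) :
    Submodule ℝ (EuclideanSpace ℝ (Fin p)) :=
  Submodule.span ℝ (Set.range fun j => WithLp.toLp 2 (R *ᵥ Pi.single (f j) 1))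

lemma finrank_coordSpace_le (R : Matrix (Fin p) (Fin p) ℝ) {r : ℕ} (f : Fin r → Fin p) :
    Module.finrank ℝ (coordSpace R f) ≤ r := by
  have := finrank_range_le_card (R := ℝ)
    (fun j => (WithLp.toLp 2 (R *ᵥ Pi.single (f j) 1) : EuclideanSpace ℝ (Fin p)))
  rwa [Fintype.card_fin] at this

lemma toLp_mulVec_mem_coordSpace (R : Matrix (Fin p) (Fin p) ℝ) {r : ℕ} {f : Fin r → Fin p}
    {w : Fin p → ℝ} (hw : ∀ i, w i ≠ 0 → i ∈ Set.range f) :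
    WithLp.toLp 2 (R *ᵥ w) ∈ coordSpace R f := by
  have h : WithLp.toLp 2 (R *ᵥ w) = ∑ i, w i • WithLp.toLp 2 (R *ᵥ Pi.single i (1 : ℝ)) := by
    ext a
    simp [Matrix.mulVec, dotProduct, WithLp.ofLp_sum, mul_comm]
  rw [h]
  refine Submodule.sum_mem _ fun i _ => ?_
  by_cases hi : w i = 0
  · simp [hi]
  · obtain ⟨j, rfl⟩ := hw i hi
    exact Submodule.smul_mem _ _ (Submodule.subset_span ⟨j, rfl⟩)

lemma exists_range_of_hammingNorm_le {r : ℕ} {w : Fin p → ℝ}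
    (hp : 0 < p) (hw : hammingNorm w ≤ r) :
    ∃ f : Fin r → Fin p, ∀ i, w i ≠ 0 → i ∈ Set.range f := by
  classical
  set A := Finset.univ.filter fun i => w i ≠ 0 with hA
  have hAc : A.card ≤ r := hw
  refine ⟨fun j => if h : (j : ℕ) < A.card then A.equivFin.symm ⟨j, h⟩ else ⟨0, hp⟩,
    fun i hi => ?_⟩
  have hiA : i ∈ A := by simp [hA, hi]
  refine ⟨⟨A.equivFin ⟨i, hiA⟩, (A.equivFin ⟨i, hiA⟩).2.trans_le hAc⟩, ?_⟩
  simp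

/-- A finite set of vectors that controls all linear maps on the `r`-sparse vectors, relative to
the norm `l2 (rootOf M *ᵥ w)`. -/
theorem exists_sparse_net {M : Matrix (Fin p) (Fin p) ℝ} (hM : M.PosDef) (hp : 0 < p) (r : ℕ)
    (j : ℕ) (hj : 0 < j) : ∃ N : Finset (Fin p → ℝ), N.card ≤ p ^ r * 5 ^ (j * r) ∧
      ∀ (F : Type) [NormedAddCommGroup F] [NormedSpace ℝ F] (A : (Fin p → ℝ) →ₗ[ℝ] F) (B : ℝ),
        0 ≤ B → (∀ c ∈ N, ‖A c‖ ≤ B * l2 (rootOf M *ᵥ c)) →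
        (∀ w, hammingNorm w ≤ r →
          ‖A w‖ ≤ B * (1 + (1 / 2) ^ j) / (1 - (1 / 2) ^ j) * l2 (rootOf M *ᵥ w)) ∧
        ∀ b : ℝ, 0 ≤ b → (∀ c ∈ N, b * l2 (rootOf M *ᵥ c) ≤ ‖A c‖) →
          ∀ w, hammingNorm w ≤ r →
            (b * (1 - (1 / 2) ^ j) - B * (1 + (1 / 2) ^ j) / (1 - (1 / 2) ^ j) * (1 / 2) ^ j) *
              l2 (rootOf M *ᵥ w) ≤ ‖A w‖ := by
  classical
  set R := rootOf M with hR
  -- Supports are listed as `r`-tuples with repetition, giving `p ^ r` nets. They are fixed before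
  -- `A`, so one net serves the predictions on all index sets.
  choose T hTc hT using fun f : Fin r → Fin p => exists_dyadic_net (coordSpace R f) j
  let lift : EuclideanSpace ℝ (Fin p) →ₗ[ℝ] (Fin p → ℝ) :=
    R⁻¹.mulVecLin ∘ₗ (WithLp.linearEquiv 2 ℝ (Fin p → ℝ)).toLinearMap
  have hlift : ∀ w : Fin p → ℝ, lift (WithLp.toLp 2 (R *ᵥ w)) = w := by
    intro w
    simp [lift, Matrix.mulVec_mulVec, Matrix.nonsing_inv_mul _ (rootOf_isUnit_det hM), hR]
  have hnorm : ∀ u : EuclideanSpace ℝ (Fin p), l2 (R *ᵥ lift u) = ‖u‖ := by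
    intro u
    simp [lift, Matrix.mulVec_mulVec, Matrix.mul_nonsing_inv _ (rootOf_isUnit_det hM), hR, l2]
  have hε1 : ((1 : ℝ) / 2) ^ j < 1 := pow_lt_one₀ (by norm_num) (by norm_num) hj.ne'
  refine ⟨Finset.univ.biUnion fun f => (T f).image fun u : coordSpace R f => lift u.1, ?_, ?_⟩
  · refine Finset.card_biUnion_le.trans ((Finset.sum_le_card_nsmul _ _ (5 ^ (j * r)) ?_).trans ?_)
    · intro f _
      refine Finset.card_image_le.trans ((hTc f).trans (Nat.pow_le_pow_right (by norm_num) ?_))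
      exact Nat.mul_le_mul_left _ (finrank_coordSpace_le R f)
    · simp
  · intro F _ _ A B hB hA
    have hmem : ∀ f, ∀ c ∈ T f, lift c.1 ∈ Finset.univ.biUnion fun f => (T f).image
        fun u : coordSpace R f => lift u.1 :=
      fun f c hc => Finset.mem_biUnion.2 ⟨f, Finset.mem_univ _, Finset.mem_image_of_mem _ hc⟩
    let A' : ∀ f : Fin r → Fin p, coordSpace R f →L[ℝ] F := fun f =>
      LinearMap.toContinuousLinearMap (A ∘ₗ lift ∘ₗ (coordSpace R f).subtype)
    have hA'B : ∀ f, ∀ c ∈ T f, ‖A' f c‖ ≤ B * ‖c‖ := by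
      intro f c hc
      have := hA _ (hmem f c hc)
      rwa [hnorm] at this
    have hval : ∀ (f : Fin r → Fin p) (w : Fin p → ℝ)
        (hw : WithLp.toLp 2 (R *ᵥ w) ∈ coordSpace R f), A' f ⟨_, hw⟩ = A w := by
      intro f w hw
      change A (lift (WithLp.toLp 2 (R *ᵥ w))) = A w
      rw [hlift]
    refine ⟨fun w hw => ?_, fun b hb hAb w hw => ?_⟩ <;>
      obtain ⟨f, hf⟩ := exists_range_of_hammingNorm_le hp hw <;>
      have hwf := toLp_mulVec_mem_coordSpace R hf
    · rw [← hval f w hwf]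
      refine ((A' f).le_opNorm _).trans ?_
      exact mul_le_mul_of_nonneg_right
        (norm_le_of_net (by positivity) hε1 (hT f) (A' f) hB (hA'B f)) (norm_nonneg _)
    · rw [← hval f w hwf]
      refine le_norm_of_net (by positivity) hε1 (hT f) (A' f) hB hb (hA'B f) ?_ ⟨_, hwf⟩
      intro c hc
      have := hAb _ (hmem f c hc)
      rwa [hnorm] at this

end SparseNets

/-! ### Chernoff bounds for one direction. -/

section GaussianTails

lemma map_multivariateGaussian_dotProduct {p : ℕ} {M : Matrix (Fin p) (Fin p) ℝ} (hM : M.PosDef)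
    {w : Fin p → ℝ} (hw : l2 (rootOf M *ᵥ w) = 1) :
    MeasurePreserving (fun x : EuclideanSpace ℝ (Fin p) => ∑ a, x a * w a)
      (multivariateGaussian 0 M) (gaussianReal 0 1) := by
  let L : StrongDual ℝ (EuclideanSpace ℝ (Fin p)) := innerSL ℝ (WithLp.toLp 2 w)
  have hL : (fun x : EuclideanSpace ℝ (Fin p) => ∑ a, x a * w a) = L := by
    ext x
    simp [L, PiLp.inner_apply]
  rw [hL]
  refine ⟨L.continuous.measurable, ?_⟩
  rw [IsGaussian.map_eq_gaussianReal]
  have h1 : (multivariateGaussian 0 M)[L] = 0 := by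
    rw [ContinuousLinearMap.integral_comp_id_comm IsGaussian.integrable_id]
    simp
  have h2 : Var[L; multivariateGaussian 0 M] = 1 := by
    have h3 := covarianceBilin_self (μ := multivariateGaussian 0 M) IsGaussian.memLp_two_id
      (WithLp.toLp 2 w)
    rw [covarianceBilin_multivariateGaussian hM.posSemidef] at h3
    have h4 : w ⬝ᵥ M *ᵥ w = 1 := by rw [← l2_rootOf_sq hM, hw, one_pow]
    rw [← h4]
    exact h3.symm
  rw [h1, h2]
  simp

/-- Negative `c` is allowed and yields the lower tail. -/
lemma gaussianReal_exp_sq {c : ℝ} (hc : c < 1 / 2) :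
    Integrable (fun z => Real.exp (c * z ^ 2)) (gaussianReal 0 1) ∧
      ∫ z, Real.exp (c * z ^ 2) ∂(gaussianReal 0 1) = (√(1 - 2 * c))⁻¹ := by
  have hpdf : ∀ z : ℝ, gaussianPDFReal 0 1 z * Real.exp (c * z ^ 2) =
      (√(2 * Real.pi))⁻¹ * Real.exp (-(1 / 2 - c) * z ^ 2) := by
    intro z
    rw [gaussianPDFReal_def]
    simp only [NNReal.coe_one, mul_one, sub_zero]
    rw [mul_assoc, ← Real.exp_add]
    congr 2
    ring
  constructor
  · rw [gaussianReal_of_var_ne_zero _ one_ne_zero,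
      integrable_withDensity_iff_integrable_smul' (measurable_gaussianPDF _ _)
        (ae_of_all _ fun _ => gaussianPDF_lt_top)]
    simp only [toReal_gaussianPDF, smul_eq_mul, hpdf]
    exact (integrable_exp_neg_mul_sq (by linarith)).const_mul _
  · rw [integral_gaussianReal_eq_integral_smul one_ne_zero]
    simp only [smul_eq_mul, hpdf]
    rw [integral_const_mul, integral_gaussian, ← Real.sqrt_inv, ← Real.sqrt_inv, ← Real.sqrt_mul]
    · congr 1
      have : 1 - 2 * c ≠ 0 := by linarith
      have : 1 / 2 - c ≠ 0 := by linarith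
      have := Real.pi_pos
      field_simp
    · have := Real.pi_pos; positivity

/-- The inequality `t ≤ 1 + (27/256) t⁴`, tangent at `t = 4/3`, replaces the truncated exponential
by a Gaussian integral at `4c`. -/
lemma gaussianReal_exp_max {c κ : ℝ} (hc : 4 * c < 1 / 2) :
    Integrable (fun z => Real.exp (c * max 0 (z ^ 2 - κ))) (gaussianReal 0 1) ∧
      ∫ z, Real.exp (c * max 0 (z ^ 2 - κ)) ∂(gaussianReal 0 1) ≤
        1 + 27 / 256 * Real.exp (-(4 * c * κ)) * (√(1 - 8 * c))⁻¹ := by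
  obtain ⟨hint, hval⟩ := gaussianReal_exp_sq hc
  have hle : ∀ z : ℝ, Real.exp (c * max 0 (z ^ 2 - κ)) ≤
      1 + 27 / 256 * Real.exp (-(4 * c * κ)) * Real.exp (4 * c * z ^ 2) := by
    intro z
    rw [mul_assoc, ← Real.exp_add]
    rcases le_total (z ^ 2 - κ) 0 with h | h
    · rw [max_eq_left h, mul_zero, Real.exp_zero]
      have := Real.exp_pos (-(4 * c * κ) + 4 * c * z ^ 2)
      linarith
    · rw [max_eq_right h]
      have h4 : Real.exp (-(4 * c * κ) + 4 * c * z ^ 2) = Real.exp (c * (z ^ 2 - κ)) ^ 4 := by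
        rw [← Real.exp_nat_mul]; congr 1; push_cast; ring
      rw [h4]
      set t := Real.exp (c * (z ^ 2 - κ))
      nlinarith [mul_nonneg (sq_nonneg (3 * t - 4))
        (by nlinarith [sq_nonneg (3 * t + 4)] : 0 ≤ 3 * t ^ 2 + 8 * t + 16)]
  have hint2 : Integrable (fun z => 1 + 27 / 256 * Real.exp (-(4 * c * κ)) *
      Real.exp (4 * c * z ^ 2)) (gaussianReal 0 1) :=
    (integrable_const _).add (hint.const_mul _)
  have hint1 : Integrable (fun z => Real.exp (c * max 0 (z ^ 2 - κ))) (gaussianReal 0 1) := by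
    refine hint2.mono' (Measurable.aestronglyMeasurable (by fun_prop)) (ae_of_all _ fun z => ?_)
    rw [Real.norm_of_nonneg (Real.exp_pos _).le]
    exact hle z
  refine ⟨hint1, (integral_mono hint1 hint2 hle).trans (le_of_eq ?_)⟩
  rw [integral_add (integrable_const _) (hint.const_mul _), integral_const_mul, hval]
  simp only [integral_const, probReal_univ, smul_eq_mul, mul_one]
  ring_nf

/-- Chernoff bound for sums of functions of one-dimensional projections of a Gaussian design. -/
lemma gaussianDesign_chernoff {p n : ℕ} {M : Matrix (Fin p) (Fin p) ℝ} (hM : M.PosDef)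
    {w : Fin p → ℝ} (hw : l2 (rootOf M *ᵥ w) = 1) {φ : ℝ → ℝ} (hφ : Measurable φ)
    (hint : Integrable (fun z => Real.exp (φ z)) (gaussianReal 0 1)) {c δ : ℝ}
    (hexp : ∫ z, Real.exp (φ z) ∂(gaussianReal 0 1) ≤ Real.exp (c - δ)) :
    (gaussianDesign p n M).real {x | c * n ≤ ∑ i, φ (((dataMatrix x)ᵀ *ᵥ w) i)} ≤
      Real.exp (-(δ * n)) := by
  have hpres := map_multivariateGaussian_dotProduct hM hw
  have hval : ∀ (x : Fin n → EuclideanSpace ℝ (Fin p)) i,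
      ((dataMatrix x)ᵀ *ᵥ w) i = ∑ a, x i a * w a := fun x i => rfl
  set f : EuclideanSpace ℝ (Fin p) → ℝ := fun x => Real.exp (φ (∑ a, x a * w a)) with hf
  have hfi : Integrable f (multivariateGaussian 0 M) :=
    hpres.integrable_comp_of_integrable hint
  have hfv : ∫ x, f x ∂(multivariateGaussian 0 M) ≤ Real.exp (c - δ) := by
    refine le_trans (le_of_eq ?_) hexp
    rw [← hpres.map_eq, integral_map hpres.measurable.aemeasurable]
    exact (by fun_prop : Measurable fun z => Real.exp (φ z)).aestronglyMeasurable
  have hprod : Integrable (fun x : Fin n → EuclideanSpace ℝ (Fin p) => ∏ i, f (x i))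
      (gaussianDesign p n M) := Integrable.fintype_prod (fun _ => hfi)
  have hmarkov := mul_meas_ge_le_integral_of_nonneg (μ := gaussianDesign p n M)
    (ae_of_all _ fun x => Finset.prod_nonneg fun i _ => (Real.exp_pos _).le) hprod
    (Real.exp (c * n))
  have hset : {x : Fin n → EuclideanSpace ℝ (Fin p) | Real.exp (c * n) ≤ ∏ i, f (x i)} =
      {x | c * n ≤ ∑ i, φ (((dataMatrix x)ᵀ *ᵥ w) i)} := by
    ext x
    simp only [hf, Set.mem_ofPred_eq, ← Real.exp_sum, Real.exp_le_exp, hval]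
  have hpow : ∫ x : Fin n → EuclideanSpace ℝ (Fin p), ∏ i, f (x i) ∂(gaussianDesign p n M) ≤
      Real.exp ((c - δ) * n) := by
    rw [gaussianDesign, integral_fintype_prod_eq_pow, Fintype.card_fin, mul_comm, Real.exp_nat_mul]
    exact pow_le_pow_left₀ (integral_nonneg fun x => (Real.exp_pos _).le) hfv n
  rw [hset] at hmarkov
  have h1 := hmarkov.trans hpow
  rw [show (c - δ) * n = c * n + -(δ * n) by ring, Real.exp_add] at h1
  exact le_of_mul_le_mul_left h1 (Real.exp_pos _)

/-- The predictions `z` concentrate, and no small set of coordinates carries much of their mass. -/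
def IsSpread {n : ℕ} (z : Fin n → ℝ) (σ : ℝ) : Prop :=
  ∑ i, z i ^ 2 ≤ 13 / 10 * n * σ ^ 2 ∧ 98 / 100 * n * σ ^ 2 ≤ ∑ i, z i ^ 2 ∧
    ∀ T : Finset (Fin n), (T.card : ℝ) ≤ n / 65 → ∑ i ∈ T, z i ^ 2 ≤ 192 / 1000 * n * σ ^ 2

lemma isSpread_zero {n : ℕ} : IsSpread (0 : Fin n → ℝ) 0 := by
  simp [IsSpread]

lemma IsSpread.smul {n : ℕ} {z : Fin n → ℝ} {σ : ℝ} (h : IsSpread z σ) (c : ℝ) :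
    IsSpread (c • z) (c * σ) := by
  have hs : ∀ T : Finset (Fin n), ∑ i ∈ T, (c • z) i ^ 2 = c ^ 2 * ∑ i ∈ T, z i ^ 2 := fun T => by
    rw [Finset.mul_sum]
    exact Finset.sum_congr rfl fun i _ => by simp [mul_pow]
  have hc := sq_nonneg c
  refine ⟨?_, ?_, fun T hT => ?_⟩
  · rw [hs]; nlinarith [mul_le_mul_of_nonneg_left h.1 hc]
  · rw [hs]; nlinarith [mul_le_mul_of_nonneg_left h.2.1 hc]
  · rw [hs]; nlinarith [mul_le_mul_of_nonneg_left (h.2.2 T hT) hc]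

/-- Truncation at `125/12` bounds all sets `T` at once: `(125/12)/65 + 0.00380923/0.12 = 0.192`. -/
lemma isSpread_one_of_lt {n : ℕ} {z : Fin n → ℝ}
    (h1 : ∑ i, (95 / 1000 : ℝ) * z i ^ 2 < 1235 / 10000 * n)
    (h2 : ∑ i, -(201 / 20000 : ℝ) * z i ^ 2 < -(9849 / 1000000) * n)
    (h3 : ∑ i, (12 / 100 : ℝ) * max 0 (z i ^ 2 - 125 / 12) < 380923 / 100000000 * n) :
    IsSpread z 1 := by
  rw [← Finset.mul_sum] at h1 h2 h3
  refine ⟨by linarith, by linarith, fun T hT => ?_⟩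
  have h4 : ∑ i ∈ T, z i ^ 2 ≤ ∑ i ∈ T, (125 / 12 + max 0 (z i ^ 2 - 125 / 12)) :=
    Finset.sum_le_sum fun i _ => by linarith [le_max_right 0 (z i ^ 2 - 125 / 12)]
  have h5 : ∑ i ∈ T, max 0 (z i ^ 2 - 125 / 12) ≤ ∑ i, max 0 (z i ^ 2 - 125 / 12) :=
    Finset.sum_le_sum_of_subset_of_nonneg (Finset.subset_univ _) fun i _ _ => le_max_left _ _
  rw [Finset.sum_add_distrib, Finset.sum_const, nsmul_eq_mul] at h4
  linarith

lemma exp_neg_five_le : Real.exp (-5) ≤ 6738 / 1000000 := by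
  have h : Real.exp (-5) = (Real.exp 1 ^ 5)⁻¹ := by
    rw [← Real.exp_nat_mul, Real.exp_neg]; norm_num
  rw [h, inv_le_comm₀ (by positivity) (by norm_num)]
  calc (6738 / 1000000 : ℝ)⁻¹ ≤ 2.7182818283 ^ 5 := by norm_num
    _ ≤ Real.exp 1 ^ 5 := by gcongr; exact Real.exp_one_gt_d9.le

lemma gaussianDesign_not_isSpread_one {p n : ℕ} {M : Matrix (Fin p) (Fin p) ℝ} (hM : M.PosDef)
    {w : Fin p → ℝ} (hw : l2 (rootOf M *ᵥ w) = 1) :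
    (gaussianDesign p n M).real {x | ¬ IsSpread ((dataMatrix x)ᵀ *ᵥ w) 1} ≤
      3 * Real.exp (-(1 / 100000 * n)) := by
  have : IsProbabilityMeasure (gaussianDesign p n M) := by unfold gaussianDesign; infer_instance
  -- The exponents `0.095`, `-0.01005` and `0.12` make the square roots rational: `0.9`, `1.01` and
  -- `0.2`.
  have h1 := gaussianDesign_chernoff (n := n) hM hw (φ := fun z => (95 / 1000 : ℝ) * z ^ 2)
    (by fun_prop) (gaussianReal_exp_sq (by norm_num)).1 (c := 1235 / 10000) (δ := 1 / 100000) (by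
      rw [(gaussianReal_exp_sq (by norm_num)).2,
        show (1 - 2 * (95 / 1000) : ℝ) = (9 / 10) ^ 2 by norm_num, Real.sqrt_sq (by norm_num)]
      refine le_trans ?_ (Real.add_one_le_exp _)
      norm_num)
  have h2 := gaussianDesign_chernoff (n := n) hM hw (φ := fun z => -(201 / 20000 : ℝ) * z ^ 2)
    (by fun_prop) (gaussianReal_exp_sq (by norm_num)).1 (c := -(9849 / 1000000))
    (δ := 1 / 100000) (by
      rw [(gaussianReal_exp_sq (by norm_num)).2,
        show (1 - 2 * -(201 / 20000) : ℝ) = (101 / 100) ^ 2 by norm_num, Real.sqrt_sq (by norm_num)]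
      refine le_trans ?_ (Real.add_one_le_exp _)
      norm_num)
  have h3 := gaussianDesign_chernoff (n := n) hM hw
    (φ := fun z => (12 / 100 : ℝ) * max 0 (z ^ 2 - 125 / 12))
    (by fun_prop) (gaussianReal_exp_max (by norm_num)).1 (c := 380923 / 100000000)
    (δ := 1 / 100000) (by
      refine (gaussianReal_exp_max (by norm_num)).2.trans ?_
      rw [show (1 - 8 * (12 / 100) : ℝ) = (1 / 5) ^ 2 by norm_num, Real.sqrt_sq (by norm_num),
        show -(4 * (12 / 100) * (125 / 12)) = (-5 : ℝ) by norm_num]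
      refine le_trans ?_ (Real.add_one_le_exp _)
      linarith [exp_neg_five_le])
  have hsub : {x : Fin n → EuclideanSpace ℝ (Fin p) | ¬ IsSpread ((dataMatrix x)ᵀ *ᵥ w) 1} ⊆
      ({x | 1235 / 10000 * n ≤ ∑ i, (95 / 1000 : ℝ) * ((dataMatrix x)ᵀ *ᵥ w) i ^ 2} ∪
        {x | -(9849 / 1000000) * n ≤ ∑ i, -(201 / 20000 : ℝ) * ((dataMatrix x)ᵀ *ᵥ w) i ^ 2}) ∪
        {x | 380923 / 100000000 * n ≤
          ∑ i, (12 / 100 : ℝ) * max 0 (((dataMatrix x)ᵀ *ᵥ w) i ^ 2 - 125 / 12)} := by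
    intro x hx
    by_contra hne
    simp only [Set.mem_union, Set.mem_ofPred_eq, not_or, not_le] at hne
    exact hx (isSpread_one_of_lt hne.1.1 hne.1.2 hne.2)
  have h4 := measureReal_mono (μ := gaussianDesign p n M) hsub
  have h5 := h4.trans ((measureReal_union_le _ _).trans
    (add_le_add_left (measureReal_union_le _ _) _))
  linarith

/-- A fixed vector has spread predictions with exponentially high probability. -/
lemma gaussianDesign_not_isSpread {p n : ℕ} {M : Matrix (Fin p) (Fin p) ℝ} (hM : M.PosDef)
    (w : Fin p → ℝ) :
    (gaussianDesign p n M).real {x | ¬ IsSpread ((dataMatrix x)ᵀ *ᵥ w) (l2 (rootOf M *ᵥ w))} ≤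
      3 * Real.exp (-(1 / 100000 * n)) := by
  have : IsProbabilityMeasure (gaussianDesign p n M) := by unfold gaussianDesign; infer_instance
  rcases eq_or_ne (l2 (rootOf M *ᵥ w)) 0 with h0 | hne
  · have hw := l2_rootOf_eq_zero hM h0
    have : {x : Fin n → EuclideanSpace ℝ (Fin p) |
        ¬ IsSpread ((dataMatrix x)ᵀ *ᵥ w) (l2 (rootOf M *ᵥ w))} = ∅ := by
      ext x
      simp [hw, l2_zero, isSpread_zero]
    rw [this, measureReal_empty]
    positivity
  · set σ := l2 (rootOf M *ᵥ w) with hσ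
    have hσ0 : 0 < σ := lt_of_le_of_ne (l2_nonneg _) hne.symm
    have hunit : l2 (rootOf M *ᵥ (σ⁻¹ • w)) = 1 := by
      rw [Matrix.mulVec_smul, l2, WithLp.toLp_smul, norm_smul, Real.norm_of_nonneg (by positivity)]
      exact inv_mul_cancel₀ hne
    have hsub : {x : Fin n → EuclideanSpace ℝ (Fin p) | ¬ IsSpread ((dataMatrix x)ᵀ *ᵥ w) σ} ⊆
        {x | ¬ IsSpread ((dataMatrix x)ᵀ *ᵥ (σ⁻¹ • w)) 1} := by
      intro x hx hsp
      have := IsSpread.smul hsp σ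
      rw [Matrix.mulVec_smul, smul_smul, mul_inv_cancel₀ hne, one_smul, mul_one] at this
      exact hx this
    exact (measureReal_mono hsub).trans (gaussianDesign_not_isSpread_one hM hunit)

end GaussianTails

/-! ### Uniform bounds and Gaussian design guarantees. -/

section GaussianDesign

variable {p n : ℕ}

/-- The restricted properties of a Gaussian design, at sparsity level `r`. -/
def IsSpreadDesign (X : Matrix (Fin p) (Fin n) ℝ) (M : Matrix (Fin p) (Fin p) ℝ) (r : ℕ) : Prop :=
  ∀ w : Fin p → ℝ, hammingNorm w ≤ r →
    ∑ i, (Xᵀ *ᵥ w) i ^ 2 ≤ 4 / 3 * n * l2 (rootOf M *ᵥ w) ^ 2 ∧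
    975 / 1000 * n * l2 (rootOf M *ᵥ w) ^ 2 ≤ ∑ i, (Xᵀ *ᵥ w) i ^ 2 ∧
    ∀ T : Finset (Fin n), (T.card : ℝ) ≤ n / 65 →
      ∑ i ∈ T, (Xᵀ *ᵥ w) i ^ 2 ≤ 193 / 1000 * n * l2 (rootOf M *ᵥ w) ^ 2

/-- The predictions on the active set, as a linear map into Euclidean space. -/
noncomputable def predictOn (X : Matrix (Fin p) (Fin n) ℝ) (T : Finset (Fin n)) :
    (Fin p → ℝ) →ₗ[ℝ] EuclideanSpace ℝ T :=
  (WithLp.linearEquiv 2 ℝ (T → ℝ)).symm.toLinearMap ∘ₗ ((colSub X T)ᵀ).mulVecLin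

lemma norm_predictOn_sq (X : Matrix (Fin p) (Fin n) ℝ) (T : Finset (Fin n)) (w : Fin p → ℝ) :
    ‖predictOn X T w‖ ^ 2 = ∑ i ∈ T, (Xᵀ *ᵥ w) i ^ 2 := by
  rw [← l2_colSub_sq]
  rfl

/-- A net of mesh `2⁻¹⁰` weakens `1.3`, `0.98` and `0.192` only to `4/3`, `0.975` and `0.193`. -/
lemma exists_finset_isSpreadDesign {M : Matrix (Fin p) (Fin p) ℝ} (hM : M.PosDef) (hp : 0 < p)
    (r n : ℕ) : ∃ N : Finset (Fin p → ℝ), N.card ≤ p ^ r * 5 ^ (10 * r) ∧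
      ∀ X : Matrix (Fin p) (Fin n) ℝ, (∀ c ∈ N, IsSpread (Xᵀ *ᵥ c) (l2 (rootOf M *ᵥ c))) →
        IsSpreadDesign X M r := by
  obtain ⟨N, hNc, hN⟩ := exists_sparse_net hM hp r 10 (by norm_num)
  refine ⟨N, hNc, fun X hX => ?_⟩
  have hn : (0 : ℝ) ≤ n := Nat.cast_nonneg n
  have habove : ∀ (T : Finset (Fin n)) (B : ℝ), 0 ≤ B → (∀ c ∈ N, ∑ i ∈ T, (Xᵀ *ᵥ c) i ^ 2 ≤
      B * n * l2 (rootOf M *ᵥ c) ^ 2) → ∀ c ∈ N,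
        ‖predictOn X T c‖ ≤ √(B * n) * l2 (rootOf M *ᵥ c) := by
    intro T B hB h c hc
    refine abs_le_of_sq_le_sq' (a := ‖predictOn X T c‖) ?_
      (mul_nonneg (Real.sqrt_nonneg _) (l2_nonneg _)) |>.2
    rw [norm_predictOn_sq, mul_pow, Real.sq_sqrt (by positivity)]
    exact h c hc
  have hupper : ∀ (T : Finset (Fin n)) (B : ℝ), 0 ≤ B → (∀ c ∈ N, ∑ i ∈ T, (Xᵀ *ᵥ c) i ^ 2 ≤
      B * n * l2 (rootOf M *ᵥ c) ^ 2) → ∀ w, hammingNorm w ≤ r → ∑ i ∈ T, (Xᵀ *ᵥ w) i ^ 2 ≤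
        B * (1025 / 1023) ^ 2 * n * l2 (rootOf M *ᵥ w) ^ 2 := by
    intro T B hB h w hw
    have h1 := (hN _ (predictOn X T) (√(B * n)) (Real.sqrt_nonneg _) (habove T B hB h)).1 w hw
    have h2 := pow_le_pow_left₀ (norm_nonneg _) h1 2
    rw [norm_predictOn_sq] at h2
    refine h2.trans (le_of_eq ?_)
    rw [show ∀ A L : ℝ, (A * (1 + (1 / 2) ^ 10) / (1 - (1 / 2) ^ 10) * L) ^ 2 =
      A ^ 2 * (1025 / 1023) ^ 2 * L ^ 2 by intros; ring, Real.sq_sqrt (by positivity)]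
    ring
  intro w hw
  have hV := sq_nonneg (l2 (rootOf M *ᵥ w))
  refine ⟨?_, ?_, fun T hT => ?_⟩
  · have h := hupper Finset.univ (13 / 10) (by norm_num) (fun c hc => (hX c hc).1) w hw
    have : 0 ≤ (n : ℝ) * l2 (rootOf M *ᵥ w) ^ 2 := by positivity
    nlinarith
  · have h := (hN _ (predictOn X Finset.univ) (√(13 / 10 * n)) (Real.sqrt_nonneg _)
      (habove Finset.univ (13 / 10) (by norm_num) fun c hc => (hX c hc).1)).2
      (√(98 / 100 * n)) (Real.sqrt_nonneg _) (fun c hc => by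
        refine abs_le_of_sq_le_sq' (a := √(98 / 100 * n) * l2 (rootOf M *ᵥ c)) ?_
          (norm_nonneg _) |>.2
        rw [norm_predictOn_sq, mul_pow, Real.sq_sqrt (by positivity)]
        exact (hX c hc).2.1) w hw
    rw [Real.sqrt_mul (by norm_num), Real.sqrt_mul (by norm_num)] at h
    have h98 : (9899 / 10000 : ℝ) ≤ √(98 / 100) := Real.le_sqrt_of_sq_le (by norm_num)
    have h13 : √(13 / 10) ≤ (11402 / 10000 : ℝ) := Real.sqrt_le_iff.2 (by norm_num)
    have hsn : 0 ≤ √(n : ℝ) * l2 (rootOf M *ᵥ w) :=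
      mul_nonneg (Real.sqrt_nonneg _) (l2_nonneg _)
    have h1 : 9876 / 10000 * (√(n : ℝ) * l2 (rootOf M *ᵥ w)) ≤
        ‖predictOn X Finset.univ w‖ := by
      refine le_trans ?_ h
      rw [show ∀ A B L : ℝ, (A * √(n : ℝ) * (1 - (1 / 2) ^ 10) - B * √(n : ℝ) * (1 + (1 / 2) ^ 10) /
        (1 - (1 / 2) ^ 10) * (1 / 2) ^ 10) * L = (A * (1023 / 1024) -
          B * (1025 / 1023 / 1024)) * (√(n : ℝ) * L) by intros; ring]
      exact mul_le_mul_of_nonneg_right (by linarith) hsn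
    have h2 := pow_le_pow_left₀ (by positivity) h1 2
    rw [norm_predictOn_sq, mul_pow, mul_pow, Real.sq_sqrt hn] at h2
    have : 0 ≤ (n : ℝ) * l2 (rootOf M *ᵥ w) ^ 2 := by positivity
    nlinarith
  · have h := hupper T (192 / 1000) (by norm_num) (fun c hc => (hX c hc).2.2 T hT) w hw
    have : 0 ≤ (n : ℝ) * l2 (rootOf M *ᵥ w) ^ 2 := by positivity
    nlinarith

lemma gaussianDesign_not_isSpreadDesign {M : Matrix (Fin p) (Fin p) ℝ} (hM : M.PosDef)
    (hp : 0 < p) (r : ℕ) :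
    (gaussianDesign p n M).real {x | ¬ IsSpreadDesign (dataMatrix x) M r} ≤
      (p : ℝ) ^ r * 5 ^ (10 * r) * (3 * Real.exp (-(1 / 100000 * n))) := by
  have : IsProbabilityMeasure (gaussianDesign p n M) := by unfold gaussianDesign; infer_instance
  obtain ⟨N, hNc, hN⟩ := exists_finset_isSpreadDesign hM hp r n
  have hsub : {x : Fin n → EuclideanSpace ℝ (Fin p) | ¬ IsSpreadDesign (dataMatrix x) M r} ⊆
      ⋃ c ∈ N, {x | ¬ IsSpread ((dataMatrix x)ᵀ *ᵥ c) (l2 (rootOf M *ᵥ c))} := by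
    intro x hx
    by_contra hne
    simp only [Set.mem_iUnion, Set.mem_ofPred_eq, exists_prop, not_exists, not_and, not_not] at hne
    exact hx (hN _ hne)
  refine (measureReal_mono hsub (measure_ne_top _ _)).trans ((measureReal_biUnion_finset_le _ _).trans ?_)
  refine (Finset.sum_le_card_nsmul _ _ _ fun c _ => gaussianDesign_not_isSpread hM c).trans ?_
  rw [nsmul_eq_mul]
  gcongr
  exact_mod_cast hNc

/-- Half of the exponent pays for the net, of size at most `p ^ (25 r)` as `5¹⁰ ≤ 2²⁴`; the other
half pays for `3 n¹⁰` through the term of order 11 of the exponential series. -/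
lemma exists_sample_size : ∃ C : ℝ, 1000000 ≤ C ∧ ∀ p r n : ℕ, 2 ≤ p → 1 ≤ r →
    C * (r * Real.log p) ≤ n →
      (p : ℝ) ^ r * 5 ^ (10 * r) * (3 * Real.exp (-(1 / 100000 * n))) ≤ 1 / (n : ℝ) ^ 10 := by
  refine ⟨6 * Nat.factorial 11 * 200000 ^ 11, by norm_num [Nat.factorial], ?_⟩
  intro p r n hp hr hn
  have hp' : (2 : ℝ) ≤ p := by exact_mod_cast hp
  have hr' : (1 : ℝ) ≤ r := by exact_mod_cast hr
  have hlog : 1 / 2 ≤ Real.log p := by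
    refine le_trans ?_ (Real.log_le_log (by norm_num) hp')
    linarith [Real.log_two_gt_d9]
  have hrl : 1 / 2 ≤ r * Real.log p := by nlinarith
  have hfac : (1 : ℝ) ≤ Nat.factorial 11 := by norm_num [Nat.factorial]
  have hn1 : 3 * Nat.factorial 11 * (200000 : ℝ) ^ 11 ≤ n := by
    refine le_trans ?_ hn
    nlinarith [mul_le_mul_of_nonneg_left hrl
      (by positivity : (0 : ℝ) ≤ 6 * Nat.factorial 11 * 200000 ^ 11)]
  have hn0 : (0 : ℝ) < n := lt_of_lt_of_le (by positivity) hn1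
  have hcount : (p : ℝ) ^ r * 5 ^ (10 * r) ≤ Real.exp (1 / 200000 * n) := by
    have h1 : (5 : ℝ) ^ 10 ≤ p ^ 24 := by
      calc (5 : ℝ) ^ 10 ≤ 2 ^ 24 := by norm_num
        _ ≤ (p : ℝ) ^ 24 := by gcongr
    calc (p : ℝ) ^ r * 5 ^ (10 * r) = p ^ r * (5 ^ 10) ^ r := by rw [pow_mul]
      _ ≤ (p : ℝ) ^ r * (p ^ 24) ^ r := by gcongr
      _ = (p : ℝ) ^ (25 * r) := by rw [← pow_mul, ← pow_add]; congr 1; ring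
      _ = Real.exp (25 * (r * Real.log p)) := by
        rw [← Real.exp_log (by positivity : (0 : ℝ) < p ^ (25 * r)), Real.log_pow]
        congr 1; push_cast; ring
      _ ≤ Real.exp (1 / 200000 * n) := by
        rw [Real.exp_le_exp]
        have : (5000000 : ℝ) ≤ 6 * Nat.factorial 11 * 200000 ^ 11 := by norm_num [Nat.factorial]
        nlinarith
  have htail : 3 * (n : ℝ) ^ 10 ≤ Real.exp (1 / 200000 * n) := by
    refine le_trans ?_ (Real.pow_div_factorial_le_exp (1 / 200000 * (n : ℝ)) (by positivity) 11)
    rw [le_div_iff₀ (by positivity), mul_pow, one_div, inv_pow, ← div_eq_inv_mul,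
      le_div_iff₀ (by positivity)]
    calc 3 * (n : ℝ) ^ 10 * Nat.factorial 11 * 200000 ^ 11
        = (n : ℝ) ^ 10 * (3 * Nat.factorial 11 * 200000 ^ 11) := by ring
      _ ≤ (n : ℝ) ^ 10 * n := by gcongr
      _ = (n : ℝ) ^ 11 := by ring
  rw [le_div_iff₀ (by positivity)]
  have hsplit : Real.exp (-(1 / 100000 * (n : ℝ))) =
      (Real.exp (1 / 200000 * n))⁻¹ * (Real.exp (1 / 200000 * n))⁻¹ := by
    rw [← Real.exp_neg, ← Real.exp_add]; congr 1; ring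
  rw [hsplit]
  set e := Real.exp (1 / 200000 * (n : ℝ)) with he
  have he0 : 0 < e := Real.exp_pos _
  calc (p : ℝ) ^ r * 5 ^ (10 * r) * (3 * (e⁻¹ * e⁻¹)) * n ^ 10
      = ((p : ℝ) ^ r * 5 ^ (10 * r)) * (3 * n ^ 10) * (e⁻¹ * e⁻¹) := by ring
    _ ≤ e * e * (e⁻¹ * e⁻¹) := by gcongr
    _ = 1 := by field_simp

lemma hammingNorm_sub_le {ι : Type*} [Fintype ι] (v w : ι → ℝ) :
    hammingNorm (v - w) ≤ hammingNorm v + hammingNorm w := by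
  classical
  refine (hammingNorm_le_card_of_support (J := Finset.univ.filter (fun i => v i ≠ 0) ∪
    Finset.univ.filter (fun i => w i ≠ 0)) fun i hi => ?_).trans (Finset.card_union_le _ _)
  simp only [Finset.mem_union, Finset.mem_filter, Finset.mem_univ, true_and, not_or,
    not_not] at hi
  simp [hi.1, hi.2]

variable {X : Matrix (Fin p) (Fin n) ℝ} {M : Matrix (Fin p) (Fin p) ℝ} {r : ℕ}

lemma dropCount_le_div {β : ℝ} (h0 : 0 ≤ β) (h1 : β < 1 / 65) :
    (dropCount β n : ℝ) ≤ n / 65 := by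
  have h : (dropCount β n : ℝ) ≤ β * n := Nat.floor_le (by positivity)
  nlinarith [(Nat.cast_nonneg n : (0 : ℝ) ≤ n)]

/-- Subtract the mass on the small complement: `0.975 - 0.193 = 0.782`. -/
lemma IsSpreadDesign.srsc (hM : M.PosDef) (h : IsSpreadDesign X M r) {r' : ℕ} (hr : r' ≤ r)
    {β : ℝ} (h0 : 0 ≤ β) (h1 : β < 1 / 65) :
    SRSC ((rootOf M)⁻¹ * X) (rootOf M) (keepCount β n) r' (782 / 1000 * n) := by
  intro S hS s₁ s₂ hs w₁ w₂ hw₁ hw₂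
  have hw : hammingNorm (w₁ - w₂) ≤ r := by
    have := hammingNorm_sub_le w₁ w₂
    omega
  rw [l2_colSub_sq, whitened_mulVec hM]
  have hcard : (Sᶜ.card : ℝ) ≤ n / 65 := by
    refine le_trans (le_of_eq ?_) (dropCount_le_div h0 h1)
    have := keepCount_add_dropCount (n := n) h0 (h1.trans (by norm_num))
    rw [Finset.card_compl, hS, Fintype.card_fin]
    exact_mod_cast (by omega : n - keepCount β n = dropCount β n)
  have h2 := (h _ hw).2.1
  have h3 := (h _ hw).2.2 Sᶜ hcard
  rw [← Finset.sum_compl_add_sum S] at h2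
  linarith

lemma IsSpreadDesign.srss (hM : M.PosDef) (h : IsSpreadDesign X M r) {r' : ℕ} (hr : r' ≤ r)
    {β : ℝ} (h0 : 0 ≤ β) (h1 : β < 1 / 65) :
    SRSS ((rootOf M)⁻¹ * X) (rootOf M) (dropCount β n) r' (193 / 1000 * n) := by
  intro S hS s₁ s₂ hs w₁ w₂ hw₁ hw₂
  have hw : hammingNorm (w₁ - w₂) ≤ r := by
    have := hammingNorm_sub_le w₁ w₂
    omega
  rw [l2_colSub_sq, whitened_mulVec hM]
  exact (h _ hw).2.2 S (hS ▸ dropCount_le_div h0 h1)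

lemma IsSpreadDesign.srss_univ (hM : M.PosDef) (h : IsSpreadDesign X M r) :
    SRSS ((rootOf M)⁻¹ * X) (rootOf M) n r (4 / 3 * n) := by
  intro S hS s₁ s₂ hs w₁ w₂ hw₁ hw₂
  have hw : hammingNorm (w₁ - w₂) ≤ r := by
    have := hammingNorm_sub_le w₁ w₂
    omega
  rw [l2_colSub_sq, whitened_mulVec hM, (Finset.card_eq_iff_eq_univ S).1 (by simpa using hS)]
  exact (h _ hw).1

/-- Since `1/η = 391/386` has logarithm at least `5/391`, dividing by it costs a factor below `79`.
The value of `g` is `2` for the exact update and `4` for IHT. -/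
lemma iterations_le {N l g B ε : ℝ} (hN : 0 < N) (hl : 0 < l) (hg0 : 0 < g) (hg : g ≤ 4)
    (hB : 0 ≤ B) (hε : 0 < ε) :
    1 + Real.log (g * √(N * (193 / 1000 * N) / l) / (782 / 1000 * N) * (1 / √N * (B / ε))) /
        Real.log (1 / (4 * (193 / 1000 * N) / (782 / 1000 * N))) ≤
      160 * (1 + max 0 (Real.log (1 / √(N * l) * (B / ε)))) := by
  have hη : 1 / (4 * (193 / 1000 * N) / (782 / 1000 * N)) = 391 / 386 := by field_simp; norm_num
  have hden : 5 / 391 ≤ Real.log (391 / 386) := by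
    refine le_trans (le_of_eq ?_) (Real.one_sub_inv_le_log_of_pos (by norm_num))
    norm_num
  rw [hη]
  set m := max 0 (Real.log (1 / √(N * l) * (B / ε))) with hm
  have hm0 : 0 ≤ m := le_max_left _ _
  have hnum : Real.log (g * √(N * (193 / 1000 * N) / l) / (782 / 1000 * N) *
      (1 / √N * (B / ε))) ≤ 2 + m := by
    rcases hB.eq_or_lt with rfl | hB
    · simp; linarith
    have hsN : 0 < √N := Real.sqrt_pos.2 hN
    have hsl : 0 < √l := Real.sqrt_pos.2 hl
    have h1 : √(N * (193 / 1000 * N) / l) = N * √(193 / 1000) / √l := by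
      rw [Real.sqrt_div (by positivity), show N * (193 / 1000 * N) = N ^ 2 * (193 / 1000) by ring,
        Real.sqrt_mul (by positivity), Real.sqrt_sq hN.le]
    have h2 : g * √(N * (193 / 1000 * N) / l) / (782 / 1000 * N) * (1 / √N * (B / ε)) =
        g * √(193 / 1000) / (782 / 1000) * (1 / √(N * l) * (B / ε)) := by
      rw [h1, Real.sqrt_mul hN.le]; field_simp
    rw [h2, Real.log_mul (by positivity) (by positivity)]
    have h3 : √(193 / 1000) ≤ (44 / 100 : ℝ) := Real.sqrt_le_iff.2 (by norm_num)
    have h4 : g * √(193 / 1000) / (782 / 1000) ≤ 3 := by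
      rw [div_le_iff₀ (by norm_num)]
      nlinarith [Real.sqrt_nonneg (193 / 1000 : ℝ)]
    have h5 := Real.log_le_sub_one_of_pos
      (by positivity : 0 < g * √(193 / 1000) / (782 / 1000))
    have h6 : Real.log (1 / √(N * l) * (B / ε)) ≤ m := le_max_right _ _
    linarith
  have hlog : 0 < Real.log (391 / 386) := lt_of_lt_of_le (by norm_num) hden
  have hdiv : Real.log (g * √(N * (193 / 1000 * N) / l) / (782 / 1000 * N) *
      (1 / √N * (B / ε))) / Real.log (391 / 386) ≤ 79 * (2 + m) := by
    rw [div_le_iff₀ hlog]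
    nlinarith
  linarith

lemma inner_iterations_le {N l κ B ε : ℝ} (hN : 0 < N) (hl : 0 < l) (hκ : 0 < κ)
    (hB : 0 ≤ B) (hε : 0 < ε) :
    12 * (κ * (4 / 3 * N / (782 / 1000 * N))) * Real.log (4 * B ^ 2 /
        ((1 - 4 * (193 / 1000 * N) / (782 / 1000 * N)) ^ 2 * l * (782 / 1000 * N) * ε ^ 2)) ≤
      1000000 * (κ * (1 + max 0 (Real.log (1 / √(N * l) * (B / ε))))) := by
  have hη : 4 * (193 / 1000 * N) / (782 / 1000 * N) = 386 / 391 := by field_simp; norm_num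
  have hr : 4 / 3 * N / (782 / 1000 * N) = 2000 / 1173 := by field_simp; norm_num
  rw [hη, hr]
  set m := max 0 (Real.log (1 / √(N * l) * (B / ε))) with hm
  have hm0 : 0 ≤ m := le_max_left _ _
  have hlog : Real.log (4 * B ^ 2 /
      ((1 - 386 / 391) ^ 2 * l * (782 / 1000 * N) * ε ^ 2)) ≤ 32000 + 2 * m := by
    rcases hB.eq_or_lt with rfl | hB
    · simp; linarith
    have hsN : 0 < √(N * l) := Real.sqrt_pos.2 (by positivity)
    have h1 : 4 * B ^ 2 / ((1 - 386 / 391) ^ 2 * l * (782 / 1000 * N) * ε ^ 2) =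
        4 / ((5 / 391) ^ 2 * (782 / 1000)) * (1 / √(N * l) * (B / ε)) ^ 2 := by
      rw [mul_pow, div_pow, div_pow, Real.sq_sqrt (by positivity)]
      field_simp
      norm_num
    rw [h1, Real.log_mul (by norm_num) (by positivity), Real.log_pow]
    have h2 := Real.log_le_sub_one_of_pos
      (by norm_num : (0 : ℝ) < 4 / ((5 / 391) ^ 2 * (782 / 1000)))
    have h3 : (4 : ℝ) / ((5 / 391) ^ 2 * (782 / 1000)) - 1 ≤ 32000 := by norm_num
    have h4 : Real.log (1 / √(N * l) * (B / ε)) ≤ m := le_max_right _ _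
    push_cast
    linarith
  have h5 := mul_le_mul_of_nonneg_left hlog (by positivity : 0 ≤ 12 * (κ * (2000 / 1173)))
  nlinarith [mul_nonneg hκ.le hm0]

lemma gaussianDesign_le_of_isSpreadDesign {C : ℝ} (hC : ∀ p r n : ℕ, 2 ≤ p → 1 ≤ r →
    C * (r * Real.log p) ≤ n →
      (p : ℝ) ^ r * 5 ^ (10 * r) * (3 * Real.exp (-(1 / 100000 * n))) ≤ 1 / (n : ℝ) ^ 10)
    (hM : M.PosDef) (hp : 2 ≤ p) (hr : 1 ≤ r) (hn : C * (r * Real.log p) ≤ n)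
    {P : (Fin n → EuclideanSpace ℝ (Fin p)) → Prop}
    (hP : ∀ x, IsSpreadDesign (dataMatrix x) M r → P x) :
    gaussianDesign p n M {x | ¬ P x} ≤ ENNReal.ofReal (1 / (n : ℝ) ^ 10) := by
  have : IsProbabilityMeasure (gaussianDesign p n M) := by unfold gaussianDesign; infer_instance
  have hsub : {x | ¬ P x} ⊆ {x | ¬ IsSpreadDesign (dataMatrix x) M r} :=
    fun x hx h => hx (hP x h)
  refine (measure_mono hsub).trans ?_
  rw [← ofReal_measureReal]
  exact ENNReal.ofReal_le_ofReal
    ((gaussianDesign_not_isSpreadDesign hM (by omega) r).trans (hC p r n hp hr hn))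

theorem exact_update_gaussian_design (A : ℝ) : ∃ C : ℝ, 0 < C ∧
    ∀ (p n sstar s : ℕ) (M : Matrix (Fin p) (Fin p) ℝ),
    2 ≤ p → 1 ≤ sstar → sstar ≤ s → M.PosDef →
    (s : ℝ) ≤ A * (sstar * condNum M) →
    C * (sstar * condNum M * Real.log p) ≤ n →
    gaussianDesign p n M
      {x | ¬ ∀ (α β : ℝ), α ≤ β → 0 ≤ β → β < 1 / 65 →
        ∀ (wstar : Fin p → ℝ) (b : Fin n → ℝ),
        hammingNorm wstar ≤ sstar → (hammingNorm b : ℝ) ≤ α * n →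
        ∀ (w : ℕ → Fin p → ℝ) (S : ℕ → Finset (Fin n)),
        IsTorrentRun (dataMatrix x) (output (dataMatrix x) wstar b) (keepCount β n)
          (SparseLSUpdate (dataMatrix x) (output (dataMatrix x) wstar b) s) w S →
        ∀ ε : ℝ, 0 < ε → ∀ t : ℕ,
        C * (1 + max 0 (Real.log (1 / √(n * lamMin M) * (l2 b / ε)))) ≤ t →
        l2 (w t - wstar) ≤ ε}
      ≤ ENNReal.ofReal (1 / (n : ℝ) ^ 10) := by
  obtain ⟨C₀, hC₀, hC⟩ := exists_sample_size
  have hA1 : 1 ≤ |A| + 1 := by linarith [abs_nonneg A]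
  -- As `condNum M ≥ 1`, the level `s + sstar` is at most `(|A| + 1) * (sstar * condNum M)`.
  refine ⟨C₀ * (|A| + 1), by positivity, ?_⟩
  intro p n sstar s M hp hs1 hss hM hsA hn
  have hκ := one_le_condNum hM (by omega)
  have hl := lamMin_pos hM (by omega)
  have hs1' : (1 : ℝ) ≤ sstar := by exact_mod_cast hs1
  have hlogp : 0 < Real.log p := Real.log_pos (by exact_mod_cast (by omega : 1 < p))
  have hsk : 1 ≤ (sstar : ℝ) * condNum M := by nlinarith
  have hr : ((s + sstar : ℕ) : ℝ) ≤ (|A| + 1) * (sstar * condNum M) := by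
    push_cast
    nlinarith [le_abs_self A]
  have hn' : C₀ * ((s + sstar : ℕ) * Real.log p) ≤ n := by
    refine le_trans ?_ hn
    calc C₀ * ((s + sstar : ℕ) * Real.log p)
        ≤ C₀ * ((|A| + 1) * (sstar * condNum M) * Real.log p) := by gcongr
      _ = _ := by ring
  have hn0 : (0 : ℝ) < n := lt_of_lt_of_le (by positivity) hn
  refine gaussianDesign_le_of_isSpreadDesign hC hM hp (r := s + sstar) (by omega) hn' ?_
  intro x hx α β hαβ hβ0 hβ1 wstar b hws hb w S hrun ε hε t ht
  have hC160 : 160 ≤ C₀ * (|A| + 1) := by nlinarith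
  have hm0 : 0 ≤ max 0 (Real.log (1 / √(n * lamMin M) * (l2 b / ε))) := le_max_left _ _
  have ht1 : 1 ≤ t := by
    have : (1 : ℝ) ≤ t := by nlinarith
    exact_mod_cast this
  refine exact_update_fixed_design hM hαβ hβ0 (hβ1.trans (by norm_num)) hss (by positivity)
    (hx.srsc hM le_rfl hβ0 hβ1) (hx.srss hM le_rfl hβ0 hβ1) ?_ hws hb hrun hε ht1 ?_
  · rw [div_lt_one (by positivity)]; nlinarith
  · refine (iterations_le hn0 hl two_pos (by norm_num) (l2_nonneg b) hε).trans (le_trans ?_ ht)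
    gcongr

theorem iht_update_gaussian_design : ∃ C : ℝ, 0 < C ∧
    ∀ (p n sstar s : ℕ) (M : Matrix (Fin p) (Fin p) ℝ),
    2 ≤ p → 1 ≤ sstar → M.PosDef →
    100 * condNum M ^ 2 * sstar ≤ s →
    C * (s * Real.log p) ≤ n →
    gaussianDesign p n M
      {x | ¬ ∀ (α β : ℝ), α ≤ β → 0 ≤ β → β < 1 / 65 →
        ∀ (wstar : Fin p → ℝ) (b : Fin n → ℝ),
        hammingNorm wstar ≤ sstar → (hammingNorm b : ℝ) ≤ α * n →
        ∀ ε : ℝ, 0 < ε → ∀ τ : ℕ,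
        C * (condNum M * (1 + max 0 (Real.log
          (1 / √(n * lamMin M) * (l2 (output (dataMatrix x) wstar b) / ε))))) ≤ τ →
        ∀ (w : ℕ → Fin p → ℝ) (S : ℕ → Finset (Fin n)),
        IsTorrentRun (dataMatrix x) (output (dataMatrix x) wstar b) (keepCount β n)
          (IHTUpdate (dataMatrix x) (output (dataMatrix x) wstar b) s
            (1 / (2 * n * lamMax M)) τ) w S →
        ∀ t : ℕ,
        C * (1 + max 0 (Real.log (1 / √(n * lamMin M) * (l2 b / ε)))) ≤ t →
        l2 (w t - wstar) ≤ ε}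
      ≤ ENNReal.ofReal (1 / (n : ℝ) ^ 10) := by
  obtain ⟨C₀, hC₀, hC⟩ := exists_sample_size
  refine ⟨C₀ * 3, by positivity, ?_⟩
  intro p n sstar s M hp hs1 hM hsκ hn
  have hκ := one_le_condNum hM (by omega)
  have hl := lamMin_pos hM (by omega)
  have hlM := hl.trans_le (lamMin_le_lamMax hM)
  have hs1' : (1 : ℝ) ≤ sstar := by exact_mod_cast hs1
  have hlogp : 0 < Real.log p := Real.log_pos (by exact_mod_cast (by omega : 1 < p))
  have hκs : (sstar : ℝ) ≤ condNum M ^ 2 * sstar := by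
    have : 1 ≤ condNum M ^ 2 := one_le_pow₀ hκ
    nlinarith
  have hss : (sstar : ℝ) ≤ s := by nlinarith
  have hr : ((2 * s + sstar : ℕ) : ℝ) ≤ 3 * s := by push_cast; linarith
  have hn' : C₀ * ((2 * s + sstar : ℕ) * Real.log p) ≤ n := by
    refine le_trans ?_ hn
    calc C₀ * ((2 * s + sstar : ℕ) * Real.log p) ≤ C₀ * (3 * s * Real.log p) := by gcongr
      _ = _ := by ring
  have hs0 : (0 : ℝ) < s := by linarith
  have hn0 : (0 : ℝ) < n := lt_of_lt_of_le (by positivity) hn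
  refine gaussianDesign_le_of_isSpreadDesign hC hM hp (r := 2 * s + sstar) (by omega) hn' ?_
  intro x hx α β hαβ hβ0 hβ1 wstar b hws hb ε hε τ hτ w S hrun t ht
  have hm0 : 0 ≤ max 0 (Real.log (1 / √(n * lamMin M) * (l2 b / ε))) := le_max_left _ _
  have ht1 : 1 ≤ t := by
    have : (1 : ℝ) ≤ t := by nlinarith
    exact_mod_cast this
  have hstep : 1 / (2 * n * lamMax M) = 2 / (3 * (lamMax M * (4 / 3 * n))) := by
    field_simp
    norm_num
  rw [hstep] at hrun
  refine iht_update_fixed_design hM hαβ hβ0 (hβ1.trans (by norm_num)) (a := 782 / 1000 * n)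
    (L := 193 / 1000 * n) (a₂ := 782 / 1000 * n) (by positivity) (by positivity)
    (hx.srsc hM le_rfl hβ0 hβ1) (hx.srss_univ hM) ?_ (hx.srsc hM (by omega) hβ0 hβ1)
    (hx.srss hM (by omega) hβ0 hβ1) ?_ hws hb hε ?_ hrun ht1 ?_
  -- This is where `100` comes from: `32 (2000/1173)²` is about `93`.
  · rw [show 4 / 3 * (n : ℝ) / (782 / 1000 * n) = 2000 / 1173 by field_simp; norm_num]
    refine le_trans ?_ hsκ
    have : 0 ≤ condNum M ^ 2 * sstar := by positivity
    nlinarith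
  · rw [div_lt_one (by positivity)]; nlinarith
  · refine (inner_iterations_le hn0 hl (by linarith) (l2_nonneg _) hε).trans (le_trans ?_ hτ)
    have h0 : 0 ≤ condNum M * (1 + max 0 (Real.log (1 / √(n * lamMin M) *
      (l2 (output (dataMatrix x) wstar b) / ε)))) :=
      mul_nonneg (by linarith) (by linarith [le_max_left 0 (Real.log (1 / √(n * lamMin M) *
        (l2 (output (dataMatrix x) wstar b) / ε)))])
    exact mul_le_mul_of_nonneg_right (by linarith) h0
  · refine (iterations_le hn0 hl four_pos le_rfl (l2_nonneg b) hε).trans (le_trans ?_ ht)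
    exact mul_le_mul_of_nonneg_right (by linarith) (by linarith)

end GaussianDesign

end TorrentHD

theorem theorem5 :
    -- fixed design, exact sparse least squares update
    (∀ (p n : ℕ) (X : Matrix (Fin p) (Fin n) ℝ) (M₀ : Matrix (Fin p) (Fin p) ℝ),
      M₀.PosDef →
      ∀ (sstar s : ℕ) (α β : ℝ) (a L : ℝ),
      α ≤ β → 0 ≤ β → β < 1 → sstar ≤ s → 0 < a →
      TorrentHD.SRSC ((TorrentHD.rootOf M₀)⁻¹ * X) (TorrentHD.rootOf M₀)
        (TorrentHD.keepCount β n) (s + sstar) a →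
      TorrentHD.SRSS ((TorrentHD.rootOf M₀)⁻¹ * X) (TorrentHD.rootOf M₀)
        (TorrentHD.dropCount β n) (s + sstar) L →
      4 * L / a < 1 →
      ∀ (wstar : Fin p → ℝ) (b : Fin n → ℝ),
      hammingNorm wstar ≤ sstar → (hammingNorm b : ℝ) ≤ α * n →
      ∀ (w : ℕ → Fin p → ℝ) (S : ℕ → Finset (Fin n)),
      TorrentHD.IsTorrentRun X (TorrentHD.output X wstar b) (TorrentHD.keepCount β n)
        (TorrentHD.SparseLSUpdate X (TorrentHD.output X wstar b) s) w S →
      ∀ ε : ℝ, 0 < ε → ∀ t : ℕ, 1 ≤ t →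
      1 + Real.log (2 * √(n * L / TorrentHD.lamMin M₀) / a *
          (1 / √n * (TorrentHD.l2 b / ε))) / Real.log (1 / (4 * L / a)) ≤ t →
      TorrentHD.l2 (w t - wstar) ≤ ε) ∧
    -- fixed design, update by iterative hard thresholding
    (∀ (p n : ℕ) (X : Matrix (Fin p) (Fin n) ℝ) (M₀ : Matrix (Fin p) (Fin p) ℝ),
      M₀.PosDef →
      ∀ (sstar s : ℕ) (α β : ℝ) (a L a₂ L₂ : ℝ),
      α ≤ β → 0 ≤ β → β < 1 → 0 < a → 0 < a₂ →
      TorrentHD.SRSC ((TorrentHD.rootOf M₀)⁻¹ * X) (TorrentHD.rootOf M₀)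
        (TorrentHD.keepCount β n) (2 * s + sstar) a₂ →
      TorrentHD.SRSS ((TorrentHD.rootOf M₀)⁻¹ * X) (TorrentHD.rootOf M₀)
        n (2 * s + sstar) L₂ →
      32 * (TorrentHD.condNum M₀ * (L₂ / a₂)) ^ 2 * sstar ≤ s →
      TorrentHD.SRSC ((TorrentHD.rootOf M₀)⁻¹ * X) (TorrentHD.rootOf M₀)
        (TorrentHD.keepCount β n) (s + sstar) a →
      TorrentHD.SRSS ((TorrentHD.rootOf M₀)⁻¹ * X) (TorrentHD.rootOf M₀)
        (TorrentHD.dropCount β n) (s + sstar) L →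
      4 * L / a < 1 →
      ∀ (wstar : Fin p → ℝ) (b : Fin n → ℝ),
      hammingNorm wstar ≤ sstar → (hammingNorm b : ℝ) ≤ α * n →
      ∀ ε : ℝ, 0 < ε → ∀ τ : ℕ,
      12 * (TorrentHD.condNum M₀ * (L₂ / a₂)) *
          Real.log (4 * TorrentHD.l2 (TorrentHD.output X wstar b) ^ 2 /
            ((1 - 4 * L / a) ^ 2 * TorrentHD.lamMin M₀ * a * ε ^ 2)) ≤ τ →
      ∀ (w : ℕ → Fin p → ℝ) (S : ℕ → Finset (Fin n)),
      TorrentHD.IsTorrentRun X (TorrentHD.output X wstar b) (TorrentHD.keepCount β n)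
        (TorrentHD.IHTUpdate X (TorrentHD.output X wstar b) s
          (2 / (3 * (TorrentHD.lamMax M₀ * L₂))) τ) w S →
      ∀ t : ℕ, 1 ≤ t →
      1 + Real.log (4 * √(n * L / TorrentHD.lamMin M₀) / a *
          (1 / √n * (TorrentHD.l2 b / ε))) / Real.log (1 / (4 * L / a)) ≤ t →
      TorrentHD.l2 (w t - wstar) ≤ ε) ∧
    -- Gaussian design, exact sparse least squares update
    (∀ A : ℝ, ∃ C : ℝ, 0 < C ∧
      ∀ (p n sstar s : ℕ) (M : Matrix (Fin p) (Fin p) ℝ),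
      2 ≤ p → 1 ≤ sstar → sstar ≤ s → M.PosDef →
      (s : ℝ) ≤ A * (sstar * TorrentHD.condNum M) →
      C * (sstar * TorrentHD.condNum M * Real.log p) ≤ n →
      TorrentHD.gaussianDesign p n M
        {x | ¬ ∀ (α β : ℝ), α ≤ β → 0 ≤ β → β < 1 / 65 →
          ∀ (wstar : Fin p → ℝ) (b : Fin n → ℝ),
          hammingNorm wstar ≤ sstar → (hammingNorm b : ℝ) ≤ α * n →
          ∀ (w : ℕ → Fin p → ℝ) (S : ℕ → Finset (Fin n)),
          TorrentHD.IsTorrentRun (TorrentHD.dataMatrix x)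
            (TorrentHD.output (TorrentHD.dataMatrix x) wstar b) (TorrentHD.keepCount β n)
            (TorrentHD.SparseLSUpdate (TorrentHD.dataMatrix x)
              (TorrentHD.output (TorrentHD.dataMatrix x) wstar b) s) w S →
          ∀ ε : ℝ, 0 < ε → ∀ t : ℕ,
          C * (1 + max 0 (Real.log
            (1 / √(n * TorrentHD.lamMin M) * (TorrentHD.l2 b / ε)))) ≤ t →
          TorrentHD.l2 (w t - wstar) ≤ ε}
        ≤ ENNReal.ofReal (1 / (n : ℝ) ^ 10)) ∧
    -- Gaussian design, update by iterative hard thresholding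
    (∃ C : ℝ, 0 < C ∧
      ∀ (p n sstar s : ℕ) (M : Matrix (Fin p) (Fin p) ℝ),
      2 ≤ p → 1 ≤ sstar → M.PosDef →
      100 * TorrentHD.condNum M ^ 2 * sstar ≤ s →
      C * (s * Real.log p) ≤ n →
      TorrentHD.gaussianDesign p n M
        {x | ¬ ∀ (α β : ℝ), α ≤ β → 0 ≤ β → β < 1 / 65 →
          ∀ (wstar : Fin p → ℝ) (b : Fin n → ℝ),
          hammingNorm wstar ≤ sstar → (hammingNorm b : ℝ) ≤ α * n →
          ∀ ε : ℝ, 0 < ε → ∀ τ : ℕ,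
          C * (TorrentHD.condNum M * (1 + max 0 (Real.log
            (1 / √(n * TorrentHD.lamMin M) *
              (TorrentHD.l2 (TorrentHD.output (TorrentHD.dataMatrix x) wstar b) / ε))))) ≤ τ →
          ∀ (w : ℕ → Fin p → ℝ) (S : ℕ → Finset (Fin n)),
          TorrentHD.IsTorrentRun (TorrentHD.dataMatrix x)
            (TorrentHD.output (TorrentHD.dataMatrix x) wstar b) (TorrentHD.keepCount β n)
            (TorrentHD.IHTUpdate (TorrentHD.dataMatrix x)
              (TorrentHD.output (TorrentHD.dataMatrix x) wstar b) s
              (1 / (2 * n * TorrentHD.lamMax M)) τ) w S →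
          ∀ t : ℕ,
          C * (1 + max 0 (Real.log
            (1 / √(n * TorrentHD.lamMin M) * (TorrentHD.l2 b / ε)))) ≤ t →
          TorrentHD.l2 (w t - wstar) ≤ ε}
        ≤ ENNReal.ofReal (1 / (n : ℝ) ^ 10)) := by
  exact ⟨
    fun _ _ _ _ hM _ _ _ _ _ _ hαβ hβ0 hβ1 hss ha hC hS hη _ _ hws hb _ _ hrun _ hε _ ht ht' =>
      TorrentHD.exact_update_fixed_design hM hαβ hβ0 hβ1 hss ha hC hS hη hws hb hrun hε ht ht',
    fun _ _ _ _ hM _ _ _ _ _ _ _ _ hαβ hβ0 hβ1 ha ha₂ hC₂ hS₂ hs hC hS hη _ _ hws hb _ hε _ hτ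
        _ _ hrun _ ht ht' =>
      TorrentHD.iht_update_fixed_design hM hαβ hβ0 hβ1 ha ha₂ hC₂ hS₂ hs hC hS hη hws hb hε hτ hrun
        ht ht',
    TorrentHD.exact_update_gaussian_design,
    TorrentHD.iht_update_gaussian_design⟩
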